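/- Let $\ell$ be a field and let $E$ be a finite directed graph, with finite sets $E^0$ of vertices and $E^1$ of edges and source and range maps $s,r:E^1\to E^0$. Let $L(E)$ be the Leavitt path algebra of $E$ over $\ell$: the unital $\ell$-algebra generated by $v$ $(v\in E^0)$ and $e,e^*$ $(e\in E^1)$ subject to $vw=\delta_{v,w}v$, $s(e)e=e=e\,r(e)$, $r(e)e^*=e^*=e^*s(e)$, $e^*f=\delta_{e,f}r(e)$, $\sum_{s(e)=v}ee^*=v$ for every $v$ that emits at least one edge, and $\sum_{v\in E^0}v=1$. It carries its canonical $\mathbb{Z}$-grading, in which $|v|=0$, $|e|=1$, $|e^*|=-1$. For a $\mathbb{Z}$-graded unital ring $A$ let $K_0^{\operatorname{gr}}(A)$ be the Grothendieck group of the monoid of (degree-preserving) isomorphism classes of finitely generated projective $\mathbb{Z}$-graded right $A$-modules under direct sum; a unital homomorphism of graded rings induces a map by extension of scalars. For a $\mathbb{Z}$-graded ring $A$ that need not be unital, let $\tilde A=A\oplus\mathbb{Z}$ be its unitalization, graded by $\tilde A_0=A_0\oplus\mathbb{Z}$ and $\tilde A_n=A_n$ for $n\neq 0$, and put $K_0^{\operatorname{gr}}(A)=\ker\bigl(K_0^{\operatorname{gr}}(\tilde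 A)\to K_0^{\operatorname{gr}}(\mathbb{Z})\bigr)$, where $\mathbb{Z}$ is concentrated in degree $0$; this is functorial in $A$ and, for unital $A$, agrees with the previous definition up to natural isomorphism. Let $R$ be a $\mathbb{Z}$-graded associative $\ell$-algebra, not necessarily unital, and let $f:L(E)\to R$ be a homomorphism of $\mathbb{Z}$-graded $\ell$-algebras ($\ell$-linear, multiplicative and degree-preserving, not necessarily preserving units). If the induced group homomorphism $K_0^{\operatorname{gr}}(f):K_0^{\operatorname{gr}}(L(E))\to K_0^{\operatorname{gr}}(R)$ is injective, then $f$ is injective. -/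

import Mathlib

open scoped TensorProduct DirectSum

/-! ### Directed graphs and Leavitt path algebras -/

set_option linter.checkUnivs false in
/-- A directed graph: sets of vertices and of edges, with source and range maps. -/
structure DirectedGraph.{u, v} where
  Vertex : Type u
  Edge : Type v
  source : Edge → Vertex
  range : Edge → Vertex

namespace DirectedGraph

/-- The generators `v`, `e`, `e*` of the Leavitt path algebra. -/
inductive LeavittGen (E : DirectedGraph)
  | vertex (v : E.Vertex)
  | edge (e : E.Edge)
  | ghost (e : E.Edge)

/-- Vertices have degree `0`, edges have degree `1`, ghost edges have degree `-1`. -/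
def LeavittGen.degree {E : DirectedGraph} : E.LeavittGen → ℤ
  | .vertex _ => 0
  | .edge _ => 1
  | .ghost _ => -1

section LeavittPathAlgebra

variable (ℓ : Type*) [CommRing ℓ] (E : DirectedGraph) [Fintype E.Vertex] [Fintype E.Edge]

open Classical in
/-- The defining relations of the Leavitt path algebra of a finite graph. A vertex `v` is regular
when it emits at least one edge (and finitely many, which is automatic here). The last relation
says that the algebra, which is unital because there are finitely many vertices, has the sum of
the vertices as its unit. -/
inductive LeavittRel : FreeAlgebra ℓ E.LeavittGen → FreeAlgebra ℓ E.LeavittGen → Prop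
  | vertex_mul_self (v : E.Vertex) :
      LeavittRel (FreeAlgebra.ι ℓ (.vertex v) * FreeAlgebra.ι ℓ (.vertex v))
        (FreeAlgebra.ι ℓ (.vertex v))
  | vertex_mul_of_ne (v w : E.Vertex) (h : v ≠ w) :
      LeavittRel (FreeAlgebra.ι ℓ (.vertex v) * FreeAlgebra.ι ℓ (.vertex w)) 0
  | source_mul_edge (e : E.Edge) :
      LeavittRel (FreeAlgebra.ι ℓ (.vertex (E.source e)) * FreeAlgebra.ι ℓ (.edge e))
        (FreeAlgebra.ι ℓ (.edge e))
  | edge_mul_range (e : E.Edge) :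
      LeavittRel (FreeAlgebra.ι ℓ (.edge e) * FreeAlgebra.ι ℓ (.vertex (E.range e)))
        (FreeAlgebra.ι ℓ (.edge e))
  | range_mul_ghost (e : E.Edge) :
      LeavittRel (FreeAlgebra.ι ℓ (.vertex (E.range e)) * FreeAlgebra.ι ℓ (.ghost e))
        (FreeAlgebra.ι ℓ (.ghost e))
  | ghost_mul_source (e : E.Edge) :
      LeavittRel (FreeAlgebra.ι ℓ (.ghost e) * FreeAlgebra.ι ℓ (.vertex (E.source e)))
        (FreeAlgebra.ι ℓ (.ghost e))
  | ghost_mul_edge_self (e : E.Edge) :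
      LeavittRel (FreeAlgebra.ι ℓ (.ghost e) * FreeAlgebra.ι ℓ (.edge e))
        (FreeAlgebra.ι ℓ (.vertex (E.range e)))
  | ghost_mul_edge_of_ne (e f : E.Edge) (h : e ≠ f) :
      LeavittRel (FreeAlgebra.ι ℓ (.ghost e) * FreeAlgebra.ι ℓ (.edge f)) 0
  | sum_edge_mul_ghost (v : E.Vertex) (h : ∃ e, E.source e = v) :
      LeavittRel
        (∑ e : E.Edge with E.source e = v,
          FreeAlgebra.ι ℓ (.edge e) * FreeAlgebra.ι ℓ (.ghost e))
        (FreeAlgebra.ι ℓ (.vertex v))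
  | sum_vertex :
      LeavittRel (∑ v : E.Vertex, FreeAlgebra.ι ℓ (.vertex v)) 1

/-- The Leavitt path algebra `L(E)` of a finite graph `E` over `ℓ`. -/
def LeavittPathAlgebra : Type _ := RingQuot (E.LeavittRel ℓ)

namespace LeavittPathAlgebra

noncomputable instance : Ring (E.LeavittPathAlgebra ℓ) :=
  inferInstanceAs (Ring (RingQuot (E.LeavittRel ℓ)))

noncomputable instance : Algebra ℓ (E.LeavittPathAlgebra ℓ) :=
  inferInstanceAs (Algebra ℓ (RingQuot (E.LeavittRel ℓ)))

/-- The quotient map from the free algebra. -/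
noncomputable def mk : FreeAlgebra ℓ E.LeavittGen →ₐ[ℓ] E.LeavittPathAlgebra ℓ :=
  RingQuot.mkAlgHom ℓ (E.LeavittRel ℓ)

/-- The image of a generator in the Leavitt path algebra. -/
noncomputable def gen (x : E.LeavittGen) : E.LeavittPathAlgebra ℓ := mk ℓ E (FreeAlgebra.ι ℓ x)

/-- The canonical `ℤ`-grading: the component of degree `n` is spanned by the words in the
generators whose total degree is `n`. -/
noncomputable def gr (n : ℤ) : Submodule ℓ (E.LeavittPathAlgebra ℓ) :=
  Submodule.span ℓ {x | ∃ w : List E.LeavittGen,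
    (w.map LeavittGen.degree).sum = n ∧ (w.map (gen ℓ E)).prod = x}

variable {ℓ E}

theorem mk_rel {x y : FreeAlgebra ℓ E.LeavittGen} (h : E.LeavittRel ℓ x y) :
    mk ℓ E x = mk ℓ E y :=
  RingQuot.mkAlgHom_rel ℓ h

theorem gen_mem (x : E.LeavittGen) : gen ℓ E x ∈ gr ℓ E x.degree :=
  Submodule.subset_span ⟨[x], by simp, by simp⟩

instance gr_gradedMonoid : SetLike.GradedMonoid (gr ℓ E) where
  one_mem := Submodule.subset_span ⟨[], by simp, by simp⟩
  mul_mem := by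
    intro i j x y hx hy
    have h : gr ℓ E i * gr ℓ E j ≤ gr ℓ E (i + j) := by
      rw [gr, gr, Submodule.span_mul_span, Submodule.span_le]
      rintro _ ⟨_, ⟨w, hw, rfl⟩, _, ⟨w', hw', rfl⟩, rfl⟩
      exact Submodule.subset_span ⟨w ++ w', by simp [hw, hw'], by simp⟩
    exact h (Submodule.mul_mem_mul hx hy)

/-- The generator, as an element of the external direct sum of the components. -/
noncomputable def genDirectSum (x : E.LeavittGen) : ⨁ n, gr ℓ E n :=
  DirectSum.of (fun n => gr ℓ E n) x.degree ⟨gen ℓ E x, gen_mem x⟩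

theorem of_eq_of {i j : ℤ} (h : i = j) (x : gr ℓ E i) (y : gr ℓ E j)
    (hxy : (x : E.LeavittPathAlgebra ℓ) = y) :
    DirectSum.of (fun n => gr ℓ E n) i x = DirectSum.of (fun n => gr ℓ E n) j y := by
  subst h
  congr 1
  exact Subtype.ext hxy

/-- The homomorphism from the free algebra to the external direct sum of the components. -/
noncomputable def freeSplit : FreeAlgebra ℓ E.LeavittGen →ₐ[ℓ] ⨁ n, gr ℓ E n :=
  FreeAlgebra.lift ℓ genDirectSum

/-- `x` represents a homogeneous element of degree `n` and is split accordingly. -/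
def SplitsIn (n : ℤ) (x : FreeAlgebra ℓ E.LeavittGen) : Prop :=
  ∃ h : mk ℓ E x ∈ gr ℓ E n, freeSplit x = DirectSum.of (fun n => gr ℓ E n) n ⟨mk ℓ E x, h⟩

theorem SplitsIn.gen (x : E.LeavittGen) {n : ℤ} (hn : x.degree = n) :
    SplitsIn n (FreeAlgebra.ι ℓ x) := by
  subst hn
  exact ⟨gen_mem x, FreeAlgebra.lift_ι_apply _ _⟩

theorem SplitsIn.mul {i j n : ℤ} {x y : FreeAlgebra ℓ E.LeavittGen} (hx : SplitsIn i x)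
    (hy : SplitsIn j y) (hn : i + j = n) : SplitsIn n (x * y) := by
  obtain ⟨h1, h2⟩ := hx
  obtain ⟨h3, h4⟩ := hy
  subst hn
  refine ⟨by rw [map_mul]; exact SetLike.mul_mem_graded h1 h3, ?_⟩
  rw [map_mul, h2, h4, DirectSum.of_mul_of]
  exact of_eq_of rfl _ _ (map_mul (mk ℓ E) x y).symm

theorem SplitsIn.zero (n : ℤ) : SplitsIn n (0 : FreeAlgebra ℓ E.LeavittGen) := by
  refine ⟨by rw [map_zero]; exact zero_mem _, ?_⟩
  rw [map_zero, ← map_zero (DirectSum.of (fun n => gr ℓ E n) n)]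
  exact of_eq_of rfl _ _ (map_zero (mk ℓ E)).symm

theorem SplitsIn.add {n : ℤ} {x y : FreeAlgebra ℓ E.LeavittGen} (hx : SplitsIn n x)
    (hy : SplitsIn n y) : SplitsIn n (x + y) := by
  obtain ⟨h1, h2⟩ := hx
  obtain ⟨h3, h4⟩ := hy
  refine ⟨by rw [map_add]; exact add_mem h1 h3, ?_⟩
  rw [map_add, h2, h4, ← map_add]
  exact of_eq_of rfl _ _ (map_add (mk ℓ E) x y).symm

theorem SplitsIn.sum {ι : Type*} {n : ℤ} {f : ι → FreeAlgebra ℓ E.LeavittGen} (s : Finset ι)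
    (h : ∀ i, SplitsIn n (f i)) : SplitsIn n (∑ i ∈ s, f i) :=
  Finset.sum_induction _ _ (fun _ _ => SplitsIn.add) (SplitsIn.zero n) fun i _ => h i

theorem SplitsIn.one : SplitsIn 0 (1 : FreeAlgebra ℓ E.LeavittGen) := by
  refine ⟨by rw [map_one]; exact SetLike.one_mem_graded _, ?_⟩
  rw [map_one, DirectSum.one_def]
  exact of_eq_of rfl _ _ (map_one (mk ℓ E)).symm

theorem freeSplit_rel {x y : FreeAlgebra ℓ E.LeavittGen} (h : E.LeavittRel ℓ x y) :
    freeSplit x = freeSplit y := by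
  have key : ∀ n, SplitsIn n x → SplitsIn n y → freeSplit x = freeSplit y := by
    rintro n ⟨h1, h2⟩ ⟨h3, h4⟩
    rw [h2, h4]
    exact of_eq_of rfl _ _ (mk_rel h)
  have hv : ∀ v, SplitsIn 0 (FreeAlgebra.ι ℓ (.vertex v : E.LeavittGen)) := fun v =>
    SplitsIn.gen (.vertex v) rfl
  have he : ∀ e, SplitsIn 1 (FreeAlgebra.ι ℓ (.edge e : E.LeavittGen)) := fun e =>
    SplitsIn.gen (.edge e) rfl
  have hg : ∀ e, SplitsIn (-1) (FreeAlgebra.ι ℓ (.ghost e : E.LeavittGen)) := fun e =>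
    SplitsIn.gen (.ghost e) rfl
  cases h with
  | vertex_mul_self v => exact key 0 ((hv v).mul (hv v) (by norm_num)) (hv v)
  | vertex_mul_of_ne v w h => exact key 0 ((hv v).mul (hv w) (by norm_num)) (.zero 0)
  | source_mul_edge e => exact key 1 ((hv _).mul (he e) (by norm_num)) (he e)
  | edge_mul_range e => exact key 1 ((he e).mul (hv _) (by norm_num)) (he e)
  | range_mul_ghost e => exact key (-1) ((hv _).mul (hg e) (by norm_num)) (hg e)
  | ghost_mul_source e => exact key (-1) ((hg e).mul (hv _) (by norm_num)) (hg e)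
  | ghost_mul_edge_self e => exact key 0 ((hg e).mul (he e) (by norm_num)) (hv _)
  | ghost_mul_edge_of_ne e f h => exact key 0 ((hg e).mul (he f) (by norm_num)) (.zero 0)
  | sum_edge_mul_ghost v h =>
    exact key 0 (SplitsIn.sum _ fun e => (he e).mul (hg e) (by norm_num)) (hv v)
  | sum_vertex => exact key 0 (SplitsIn.sum _ hv) .one

/-- The homomorphism that splits an element into its homogeneous components. -/
noncomputable def splitHom : E.LeavittPathAlgebra ℓ →ₐ[ℓ] ⨁ n, gr ℓ E n :=
  RingQuot.liftAlgHom ℓ ⟨freeSplit, fun _ _ h => freeSplit_rel h⟩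

theorem splitHom_gen (x : E.LeavittGen) : splitHom (gen ℓ E x) = genDirectSum x := by
  have : splitHom (gen ℓ E x) = freeSplit (FreeAlgebra.ι ℓ x) :=
    RingQuot.liftAlgHom_mkAlgHom_apply ..
  rw [this, freeSplit, FreeAlgebra.lift_ι_apply]

theorem splitHom_word (w : List E.LeavittGen) :
    ∃ h : (w.map (gen ℓ E)).prod ∈ gr ℓ E (w.map LeavittGen.degree).sum,
      splitHom (w.map (gen ℓ E)).prod = DirectSum.of (fun n => gr ℓ E n) _ ⟨_, h⟩ := by
  refine ⟨Submodule.subset_span ⟨w, rfl, rfl⟩, ?_⟩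
  induction w with
  | nil =>
    simp only [List.map_nil, List.prod_nil, map_one, DirectSum.one_def]
    exact of_eq_of rfl _ _ rfl
  | cons x w ih =>
    simp only [List.map_cons, List.prod_cons, map_mul, ih, splitHom_gen]
    rw [genDirectSum, DirectSum.of_mul_of]
    exact of_eq_of (by simp) _ _ rfl

noncomputable instance gr_gradedAlgebra : GradedAlgebra (gr ℓ E) :=
  GradedAlgebra.ofAlgHom (gr ℓ E) splitHom
    (by
      apply RingQuot.ringQuot_ext'
      apply FreeAlgebra.hom_ext
      funext x
      change DirectSum.coeAlgHom (gr ℓ E) (splitHom (gen ℓ E x)) = gen ℓ E x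
      rw [splitHom_gen, genDirectSum, DirectSum.coeAlgHom_of])
    (by
      rintro n ⟨x, hx⟩
      induction hx using Submodule.span_induction with
      | mem x h =>
        obtain ⟨w, rfl, rfl⟩ := h
        exact (splitHom_word w).2
      | zero =>
        rw [map_zero]
        exact (map_zero (DirectSum.of (fun n => gr ℓ E n) n)).symm
      | add x y hx hy h1 h2 =>
        rw [map_add, h1, h2, ← map_add]
        rfl
      | smul c x hx h1 =>
        rw [map_smul, h1]
        exact (DirectSum.of_smul ..).symm)

end LeavittPathAlgebra

end LeavittPathAlgebra

end DirectedGraph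

/-! ### Gradings by `ℤ` -/

namespace GradedK

universe u v w t w₁ w₂ w₃

section Internal

variable {M : Type*} [AddCommGroup M] {ℳ : ℤ → AddSubgroup M}

/-- A way to check that a family of subgroups is a grading: every element is a sum of homogeneous
ones, and a map `δ` separates the components. -/
theorem isInternal_of_split (δ : M →+ (ℤ →₀ M))
    (h1 : ∀ i, ∀ m ∈ ℳ i, δ m = Finsupp.single i m) (h2 : ∀ m, m ∈ ⨆ i, ℳ i) :
    DirectSum.IsInternal ℳ := by
  have key : ∀ (x : ⨁ i, ℳ i) (n : ℤ),
      δ (DirectSum.coeAddMonoidHom ℳ x) n = ((x n : ℳ n) : M) := by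
    intro x n
    induction x using DirectSum.induction_on with
    | zero => simp
    | of i m =>
      rw [DirectSum.coeAddMonoidHom_of, h1 i _ m.2]
      by_cases h : i = n
      · subst h; simp
      · rw [Finsupp.single_eq_of_ne (Ne.symm h), DirectSum.of_eq_of_ne _ _ _ (Ne.symm h)]; rfl
    | add x y hx hy =>
      rw [map_add, map_add, Finsupp.add_apply, hx, hy]; rfl
  constructor
  · intro x y hxy
    refine DFinsupp.ext fun n => Subtype.ext ?_
    rw [← key x n, ← key y n, hxy]
  · intro m
    induction h2 m using AddSubgroup.iSup_induction' with
    | hp i x hx => exact ⟨DirectSum.of (fun i => ℳ i) i ⟨x, hx⟩, DirectSum.coeAddMonoidHom_of ..⟩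
    | h1 => exact ⟨0, map_zero _⟩
    | hadd x y _ _ hx hy =>
      obtain ⟨a, rfl⟩ := hx
      obtain ⟨b, rfl⟩ := hy
      exact ⟨a + b, map_add _ _ _⟩

/-- The family of homogeneous components of an element. -/
noncomputable def split (h : DirectSum.IsInternal ℳ) : M →+ (ℤ →₀ M) :=
  (DirectSum.toAddMonoid fun i => (Finsupp.singleAddHom i).comp (ℳ i).subtype).comp
    (AddEquiv.ofBijective (DirectSum.coeAddMonoidHom ℳ) h).symm.toAddMonoidHom

theorem split_of_mem (h : DirectSum.IsInternal ℳ) {i : ℤ} {m : M} (hm : m ∈ ℳ i) :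
    split h m = Finsupp.single i m := by
  have : (AddEquiv.ofBijective (DirectSum.coeAddMonoidHom ℳ) h).symm m =
      DirectSum.of (fun i => ℳ i) i ⟨m, hm⟩ := by
    rw [AddEquiv.symm_apply_eq]
    exact (DirectSum.coeAddMonoidHom_of ℳ i ⟨m, hm⟩).symm
  simp [split, this]

theorem mem_iSup_of_isInternal (h : DirectSum.IsInternal ℳ) (m : M) : m ∈ ⨆ i, ℳ i := by
  obtain ⟨x, rfl⟩ := h.2 m
  induction x using DirectSum.induction_on with
  | zero => rw [map_zero]; exact zero_mem _
  | of i m => rw [DirectSum.coeAddMonoidHom_of]; exact AddSubgroup.mem_iSup_of_mem i m.2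
  | add x y hx hy => rw [map_add]; exact add_mem hx hy

theorem hom_induction (h : DirectSum.IsInternal ℳ) {P : M → Prop} (m : M)
    (hom : ∀ i, ∀ x ∈ ℳ i, P x) (add : ∀ x y, P x → P y → P (x + y)) : P m := by
  induction mem_iSup_of_isInternal h m using AddSubgroup.iSup_induction' with
  | hp i x hx => exact hom i x hx
  | h1 => exact hom 0 0 (zero_mem _)
  | hadd x y _ _ hx hy => exact add x y hx hy

end Internal

/-! ### Graded finitely generated projective modules -/

open MulOpposite in
/-- A finitely generated projective `ℤ`-graded right module over a `ℤ`-graded ring `A`.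
Right `A`-modules are modules over `Aᵐᵒᵖ`. -/
structure GrProj {A : Type u} [Ring A] (𝒜 : ℤ → AddSubgroup A) where
  carrier : Type w
  [addCommGroup : AddCommGroup carrier]
  [module : Module Aᵐᵒᵖ carrier]
  gr : ℤ → AddSubgroup carrier
  isInternal : DirectSum.IsInternal gr
  smul_mem : ∀ {i j : ℤ} {m : carrier} {a : A}, m ∈ gr i → a ∈ 𝒜 j → op a • m ∈ gr (i + j)
  [finite : Module.Finite Aᵐᵒᵖ carrier]
  [projective : Module.Projective Aᵐᵒᵖ carrier]

attribute [instance] GrProj.addCommGroup GrProj.module GrProj.finite GrProj.projective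

/-! ### Extension of scalars -/

section BaseChange

open MulOpposite

variable {A : Type u} [Ring A] {B : Type v} [Ring B] (φ : A →+* B)
  (M : Type w) [AddCommGroup M] [Module Aᵐᵒᵖ M]

/-- The relations `m ⊗ φ(a) b = m a ⊗ b`. The factors are written in the order `b ⊗ m`, so that
the right action of `B` on itself gives the action on the tensor product. -/
def balancing : Submodule Bᵐᵒᵖ (B ⊗[ℤ] M) :=
  Submodule.span Bᵐᵒᵖ
    {x | ∃ (a : A) (b : B) (m : M), x = (φ a * b) ⊗ₜ[ℤ] m - b ⊗ₜ[ℤ] (op a • m)}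

/-- The right `B`-module `M ⊗_A B` obtained from the right `A`-module `M` along `φ : A → B`. -/
def BaseChange : Type (max v w) := (B ⊗[ℤ] M) ⧸ balancing φ M

namespace BaseChange

noncomputable instance : AddCommGroup (BaseChange φ M) :=
  inferInstanceAs (AddCommGroup ((B ⊗[ℤ] M) ⧸ balancing φ M))

noncomputable instance : Module Bᵐᵒᵖ (BaseChange φ M) :=
  inferInstanceAs (Module Bᵐᵒᵖ ((B ⊗[ℤ] M) ⧸ balancing φ M))

variable {M}

/-- The quotient map from the tensor product over `ℤ`. -/
noncomputable def mk : B ⊗[ℤ] M →ₗ[Bᵐᵒᵖ] BaseChange φ M := (balancing φ M).mkQ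

/-- The pure tensor `m ⊗ b` in `M ⊗_A B`. -/
noncomputable def tmul (m : M) (b : B) : BaseChange φ M := mk φ (b ⊗ₜ[ℤ] m)

theorem tmul_add (m : M) (b c : B) : tmul φ m (b + c) = tmul φ m b + tmul φ m c := by
  rw [tmul, TensorProduct.add_tmul, map_add]; rfl

theorem add_tmul (m n : M) (b : B) : tmul φ (m + n) b = tmul φ m b + tmul φ n b := by
  rw [tmul, TensorProduct.tmul_add, map_add]; rfl

theorem smul_tmul (m : M) (b c : B) : op c • tmul φ m b = tmul φ m (b * c) := by
  rw [tmul, ← map_smul, TensorProduct.smul_tmul', op_smul_eq_mul]; rfl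

theorem tmul_mul (a : A) (m : M) (b : B) : tmul φ m (φ a * b) = tmul φ (op a • m) b := by
  rw [← sub_eq_zero, tmul, tmul, ← map_sub]
  exact (Submodule.Quotient.mk_eq_zero _).2 (Submodule.subset_span ⟨a, b, m, rfl⟩)

/-- `tmul` as a biadditive map. -/
noncomputable def tmulHom : B →+ M →+ BaseChange φ M :=
  AddMonoidHom.mk' (fun b => AddMonoidHom.mk' (fun m => tmul φ m b) fun m n => add_tmul φ m n b)
    fun b c => by ext m; exact tmul_add φ m b c

@[simp]
theorem tmulHom_apply (m : M) (b : B) : tmulHom φ b m = tmul φ m b := rfl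

theorem tmul_zero (m : M) : tmul φ m (0 : B) = 0 := by
  rw [← tmulHom_apply, map_zero, AddMonoidHom.zero_apply]

theorem zero_tmul (b : B) : tmul φ (0 : M) b = 0 := by
  rw [← tmulHom_apply, map_zero]

variable {φ}

theorem induction {P : BaseChange φ M → Prop} (x : BaseChange φ M)
    (tmul : ∀ m b, P (tmul φ m b)) (add : ∀ x y, P x → P y → P (x + y)) : P x := by
  obtain ⟨y, rfl⟩ := Submodule.Quotient.mk_surjective (balancing φ M) x
  induction y using TensorProduct.induction_on with
  | zero =>
    have := tmul 0 0
    rwa [zero_tmul] at this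
  | tmul b m => exact tmul m b
  | add x y hx hy => exact add _ _ hx hy

/-- The additive map on the tensor product over `ℤ` given by a biadditive map. -/
noncomputable def liftInt {X : Type*} [AddCommGroup X] (h : B →+ M →+ X) : B ⊗[ℤ] M →+ X :=
  TensorProduct.liftAddHom h fun n b m => by
    rw [map_zsmul, map_zsmul, AddMonoidHom.zsmul_apply]

theorem liftInt_eq_zero {X : Type*} [AddCommGroup X] (h : B →+ M →+ X)
    (bal : ∀ a b m, h (φ a * b) m = h b (op a • m)) {x : B ⊗[ℤ] M} (hx : x ∈ balancing φ M) :
    liftInt h x = 0 := by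
  have key : ∀ c : Bᵐᵒᵖ, liftInt h (c • x) = 0 := by
    unfold balancing at hx
    induction hx using Submodule.span_induction with
    | mem x hx =>
      obtain ⟨a, b, m, rfl⟩ := hx
      intro c
      rw [← op_unop c, smul_sub, TensorProduct.smul_tmul', TensorProduct.smul_tmul', map_sub,
        sub_eq_zero, op_smul_eq_mul, op_smul_eq_mul, mul_assoc]
      exact bal a (b * unop c) m
    | zero => intro c; rw [smul_zero, map_zero]
    | add x y _ _ hx hy => intro c; rw [smul_add, map_add, hx, hy, add_zero]
    | smul d x _ hx => intro c; rw [← mul_smul]; exact hx (c * d)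
  simpa using key 1

/-- The additive map out of `M ⊗_A B` given by a balanced biadditive map. -/
noncomputable def lift {X : Type*} [AddCommGroup X] (h : B →+ M →+ X)
    (bal : ∀ a b m, h (φ a * b) m = h b (op a • m)) : BaseChange φ M →+ X :=
  QuotientAddGroup.lift (balancing φ M).toAddSubgroup (liftInt h) fun _ hx =>
    liftInt_eq_zero h bal hx

@[simp]
theorem lift_tmul {X : Type*} [AddCommGroup X] (h : B →+ M →+ X)
    (bal : ∀ a b m, h (φ a * b) m = h b (op a • m)) (m : M) (b : B) :
    lift h bal (tmul φ m b) = h b m := rfl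

theorem hom_ext {X : Type*} [AddCommGroup X] {f g : BaseChange φ M →+ X}
    (h : ∀ m b, f (tmul φ m b) = g (tmul φ m b)) : f = g := by
  ext x
  induction x using induction with
  | tmul m b => exact h m b
  | add x y hx hy => rw [map_add, map_add, hx, hy]

/-- An additive map out of `M ⊗_A B` is linear when it is so on pure tensors. -/
theorem map_smul_of_tmul {X : Type*} [AddCommGroup X] [Module Bᵐᵒᵖ X] (f : BaseChange φ M →+ X)
    (h : ∀ m b c, f (tmul φ m (b * c)) = op c • f (tmul φ m b)) (c : Bᵐᵒᵖ) (x : BaseChange φ M) :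
    f (c • x) = c • f x := by
  induction x using induction with
  | tmul m b => rw [← op_unop c, smul_tmul, h]
  | add x y hx hy => rw [smul_add, map_add, map_add, smul_add, hx, hy]

instance [Module.Finite Aᵐᵒᵖ M] : Module.Finite Bᵐᵒᵖ (BaseChange φ M) := by
  obtain ⟨s, hs⟩ := Module.Finite.fg_top (R := Aᵐᵒᵖ) (M := M)
  classical
  refine ⟨⟨s.image fun m => tmul φ m (1 : B), ?_⟩⟩
  rw [eq_top_iff]
  rintro x -
  have h1 : ∀ m : M, tmul φ m (1 : B) ∈
      Submodule.span Bᵐᵒᵖ ((s.image fun m => tmul φ m (1 : B) : Finset _) : Set _) := by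
    intro m
    have hm : m ∈ Submodule.span Aᵐᵒᵖ (s : Set M) := hs ▸ Submodule.mem_top
    induction hm using Submodule.span_induction with
    | mem m hm => exact Submodule.subset_span (by simpa using ⟨m, hm, rfl⟩)
    | zero => rw [zero_tmul]; exact zero_mem _
    | add m n _ _ hm hn => rw [add_tmul]; exact add_mem hm hn
    | smul a m _ hm =>
      rw [← op_unop a, ← tmul_mul, mul_one, ← one_mul (φ (unop a)), ← smul_tmul]
      exact Submodule.smul_mem _ _ hm
  induction x using induction with
  | tmul m b =>
    rw [← one_mul b, ← smul_tmul]
    exact Submodule.smul_mem _ _ (h1 m)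
  | add x y hx hy => exact add_mem hx hy

instance [Module.Projective Aᵐᵒᵖ M] : Module.Projective Bᵐᵒᵖ (BaseChange φ M) := by
  refine .of_lifting_property'' fun f hf => ?_
  let ψ : Aᵐᵒᵖ →+* Bᵐᵒᵖ := φ.op
  let : Module Aᵐᵒᵖ (BaseChange φ M →₀ Bᵐᵒᵖ) := Module.compHom _ ψ
  let : Module Aᵐᵒᵖ (BaseChange φ M) := Module.compHom _ ψ
  let f' : (BaseChange φ M →₀ Bᵐᵒᵖ) →ₗ[Aᵐᵒᵖ] BaseChange φ M :=
    { f with map_smul' := fun a x => f.map_smul (ψ a) x }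
  let i : M →ₗ[Aᵐᵒᵖ] BaseChange φ M :=
    { toFun := fun m => tmul φ m 1
      map_add' := fun m n => add_tmul φ m n 1
      map_smul' := fun a m => by
        change _ = op (φ (unop a)) • tmul φ m 1
        rw [smul_tmul, one_mul, ← mul_one (φ (unop a)), tmul_mul, op_unop] }
  obtain ⟨g, hg⟩ := Module.projective_lifting_property f' i hf
  let G : BaseChange φ M →+ (BaseChange φ M →₀ Bᵐᵒᵖ) :=
    lift (AddMonoidHom.mk' (fun b => AddMonoidHom.mk' (fun m => op b • g m)
        fun m n => by rw [map_add, smul_add])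
        fun b c => by ext1 m; exact add_smul (op b) (op c) (g m)) <| by
      intro a b m
      change op (φ a * b) • g m = op b • g (op a • m)
      rw [map_smul, op_mul, mul_smul]
      rfl
  refine ⟨{ G with map_smul' := map_smul_of_tmul G fun m b c => ?_ }, ?_⟩
  · change op (b * c) • g m = op c • op b • g m
    rw [op_mul, mul_smul]
  · apply LinearMap.toAddMonoidHom_injective
    refine hom_ext fun m b => ?_
    change f (op b • g m) = tmul φ m b
    have : f (g m) = tmul φ m 1 := LinearMap.congr_fun hg m
    rw [map_smul, this, smul_tmul, one_mul]

section Grading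

variable (φ) in
/-- The component of degree `n` of `M ⊗_A B` is generated by the `m ⊗ b` with `m` and `b`
homogeneous and `|m| + |b| = n`. -/
noncomputable def gr (ℬ : ℤ → AddSubgroup B) (ℳ : ℤ → AddSubgroup M) (n : ℤ) :
    AddSubgroup (BaseChange φ M) :=
  AddSubgroup.closure {x | ∃ i j, i + j = n ∧ ∃ m ∈ ℳ i, ∃ b ∈ ℬ j, tmul φ m b = x}

variable {𝒜 : ℤ → AddSubgroup A} {ℬ : ℤ → AddSubgroup B} {ℳ : ℤ → AddSubgroup M}

theorem tmul_mem {i j : ℤ} {m : M} {b : B} (hm : m ∈ ℳ i) (hb : b ∈ ℬ j) :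
    tmul φ m b ∈ gr φ ℬ ℳ (i + j) :=
  AddSubgroup.subset_closure ⟨i, j, rfl, m, hm, b, hb, rfl⟩

theorem map_mem_of_tmul {X : Type*} [AddCommGroup X] (f : BaseChange φ M →+ X)
    {𝒳 : ℤ → AddSubgroup X}
    (h : ∀ i j, ∀ m ∈ ℳ i, ∀ b ∈ ℬ j, f (tmul φ m b) ∈ 𝒳 (i + j)) {n : ℤ} {x : BaseChange φ M}
    (hx : x ∈ gr φ ℬ ℳ n) : f x ∈ 𝒳 n := by
  have : gr φ ℬ ℳ n ≤ (𝒳 n).comap f := by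
    rw [gr, AddSubgroup.closure_le]
    rintro _ ⟨i, j, rfl, m, hm, b, hb, rfl⟩
    exact h i j m hm b hb
  exact this hx

theorem smul_mem [SetLike.GradedMonoid ℬ] {i j : ℤ} {x : BaseChange φ M} {b : B}
    (hx : x ∈ gr φ ℬ ℳ i) (hb : b ∈ ℬ j) : op b • x ∈ gr φ ℬ ℳ (i + j) := by
  refine map_mem_of_tmul (DistribSMul.toAddMonoidHom (BaseChange φ M) (op b))
    (𝒳 := fun n => gr φ ℬ ℳ (n + j)) ?_ hx
  intro i k m hm c hc
  change op b • tmul φ m c ∈ gr φ ℬ ℳ (i + k + j)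
  rw [smul_tmul, add_assoc]
  exact tmul_mem hm (SetLike.mul_mem_graded hc hb)

theorem isInternal [GradedRing 𝒜] [GradedRing ℬ] (hφ : ∀ {i a}, a ∈ 𝒜 i → φ a ∈ ℬ i)
    (hℳ : DirectSum.IsInternal ℳ)
    (hsmul : ∀ {i j : ℤ} {m : M} {a : A}, m ∈ ℳ i → a ∈ 𝒜 j → op a • m ∈ ℳ (i + j)) :
    DirectSum.IsInternal (gr φ ℬ ℳ) := by
  have h𝒜 := DirectSum.Decomposition.isInternal 𝒜
  have hℬ := DirectSum.Decomposition.isInternal ℬ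
  let h₀ : (ℤ →₀ B) →+ (ℤ →₀ M) →+ (ℤ →₀ BaseChange φ M) :=
    Finsupp.liftAddHom fun j => AddMonoidHom.flip <| Finsupp.liftAddHom fun i =>
      AddMonoidHom.flip <| (AddMonoidHom.compHom (Finsupp.singleAddHom (i + j))).comp (tmulHom φ)
  let h : B →+ M →+ (ℤ →₀ BaseChange φ M) :=
    ((AddMonoidHom.compHom' (split hℳ)).comp h₀).comp (split hℬ)
  have hh : ∀ i j, ∀ m ∈ ℳ i, ∀ b ∈ ℬ j, h b m = Finsupp.single (i + j) (tmul φ m b) := by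
    intro i j m hm b hb
    change h₀ (split hℬ b) (split hℳ m) = _
    rw [split_of_mem hℬ hb, split_of_mem hℳ hm]
    simp [h₀]
  have bal : ∀ a b m, h (φ a * b) m = h b (op a • m) := by
    intro a b m
    induction a using hom_induction h𝒜 with
    | add x y hx hy => rw [map_add, add_mul, map_add, AddMonoidHom.add_apply, hx, hy, op_add,
        add_smul, map_add]
    | hom k a ha =>
    induction b using hom_induction hℬ with
    | add x y hx hy => rw [mul_add, map_add, map_add, AddMonoidHom.add_apply,
        AddMonoidHom.add_apply, hx, hy]
    | hom j b hb =>
    induction m using hom_induction hℳ with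
    | add x y hx hy => rw [smul_add, map_add, map_add, hx, hy]
    | hom i m hm =>
    rw [hh i (k + j) m hm _ (SetLike.mul_mem_graded (hφ ha) hb),
      hh (i + k) j _ (hsmul hm ha) b hb, tmul_mul, add_assoc]
  refine isInternal_of_split (lift h bal) ?_ ?_
  · intro n x hx
    rw [gr] at hx
    induction hx using AddSubgroup.closure_induction with
    | mem x hx =>
      obtain ⟨i, j, rfl, m, hm, b, hb, rfl⟩ := hx
      rw [lift_tmul, hh i j m hm b hb]
    | zero => rw [map_zero, Finsupp.single_zero]
    | add x y _ _ hx hy => rw [map_add, hx, hy, Finsupp.single_add]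
    | neg x _ hx => rw [map_neg, hx, Finsupp.single_neg]
  · intro x
    induction x using induction with
    | add x y hx hy => exact add_mem hx hy
    | tmul m b =>
    induction m using hom_induction hℳ with
    | add x y hx hy => rw [add_tmul]; exact add_mem hx hy
    | hom i m hm =>
    induction b using hom_induction hℬ with
    | add x y hx hy => rw [tmul_add]; exact add_mem hx hy
    | hom j b hb => exact AddSubgroup.mem_iSup_of_mem (i + j) (tmul_mem hm hb)

end Grading

section Iso

/-- Mutually inverse maps that preserve degrees give a graded isomorphism. -/
theorem exists_equiv {X Y : Type*} [AddCommGroup X] [AddCommGroup Y] [Module Bᵐᵒᵖ X]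
    [Module Bᵐᵒᵖ Y] {𝒳 : ℤ → AddSubgroup X} {𝒴 : ℤ → AddSubgroup Y} (f : X →+ Y) (g : Y →+ X)
    (hf : ∀ (a : Bᵐᵒᵖ) x, f (a • x) = a • f x)
    (hgf : ∀ x, g (f x) = x) (hfg : ∀ y, f (g y) = y)
    (hf' : ∀ i x, x ∈ 𝒳 i → f x ∈ 𝒴 i) (hg' : ∀ i y, y ∈ 𝒴 i → g y ∈ 𝒳 i) :
    ∃ e : X ≃ₗ[Bᵐᵒᵖ] Y, ∀ i x, x ∈ 𝒳 i ↔ e x ∈ 𝒴 i :=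
  ⟨{ toFun := f, invFun := g, map_add' := map_add f, map_smul' := hf,
     left_inv := hgf, right_inv := hfg },
    fun i m => ⟨fun h => hf' i m h, fun h => by have := hg' _ _ h; rwa [← hgf m]⟩⟩

variable (φ) in
/-- The map induced by a linear map of modules. -/
noncomputable def mapHom {N : Type*} [AddCommGroup N] [Module Aᵐᵒᵖ N] (f : M →ₗ[Aᵐᵒᵖ] N) :
    BaseChange φ M →+ BaseChange φ N :=
  lift ((AddMonoidHom.compHom' f.toAddMonoidHom).comp (tmulHom φ)) fun a b m => by
    change tmul φ (f m) (φ a * b) = tmul φ (f (op a • m)) b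
    rw [tmul_mul, map_smul]

variable {N : Type*} [AddCommGroup N] [Module Aᵐᵒᵖ N] {P : Type*} [AddCommGroup P] [Module Aᵐᵒᵖ P]
  {ℬ : ℤ → AddSubgroup B} {ℳ : ℤ → AddSubgroup M} {𝒩 : ℤ → AddSubgroup N}

@[simp]
theorem mapHom_tmul (f : M →ₗ[Aᵐᵒᵖ] N) (m : M) (b : B) :
    mapHom φ f (tmul φ m b) = tmul φ (f m) b := rfl

theorem mapHom_smul (f : M →ₗ[Aᵐᵒᵖ] N) (c : Bᵐᵒᵖ) (x : BaseChange φ M) :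
    mapHom φ f (c • x) = c • mapHom φ f x :=
  map_smul_of_tmul _ (fun m b c => by rw [mapHom_tmul, mapHom_tmul, smul_tmul]) c x

theorem mapHom_mem {f : M →ₗ[Aᵐᵒᵖ] N} (hf : ∀ i m, m ∈ ℳ i → f m ∈ 𝒩 i) (n : ℤ)
    (x : BaseChange φ M) (hx : x ∈ gr φ ℬ ℳ n) : mapHom φ f x ∈ gr φ ℬ 𝒩 n :=
  map_mem_of_tmul _ (fun i j m hm b hb => by
    rw [mapHom_tmul]; exact tmul_mem (hf i m hm) hb) hx

theorem mapHom_mapHom {f : M →ₗ[Aᵐᵒᵖ] N} {g : N →ₗ[Aᵐᵒᵖ] P} (x : BaseChange φ M) :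
    mapHom φ g (mapHom φ f x) = mapHom φ (g.comp f) x := by
  induction x using induction with
  | tmul m b => rfl
  | add x y hx hy => rw [map_add, map_add, map_add, hx, hy]

theorem mapHom_id (x : BaseChange φ M) : mapHom φ (LinearMap.id : M →ₗ[Aᵐᵒᵖ] M) x = x := by
  induction x using induction with
  | tmul m b => rfl
  | add x y hx hy => rw [map_add, hx, hy]

theorem mapHom_add (f g : M →ₗ[Aᵐᵒᵖ] N) (x : BaseChange φ M) :
    mapHom φ (f + g) x = mapHom φ f x + mapHom φ g x := by
  induction x using induction with
  | tmul m b => exact add_tmul φ (f m) (g m) b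
  | add x y hx hy => rw [map_add, map_add, map_add, hx, hy, add_add_add_comm]

theorem mapHom_zero (x : BaseChange φ M) : mapHom φ (0 : M →ₗ[Aᵐᵒᵖ] N) x = 0 := by
  induction x using induction with
  | tmul m b => exact zero_tmul φ b
  | add x y hx hy => rw [map_add, hx, hy, add_zero]

theorem congr_iso (h : ∃ e : M ≃ₗ[Aᵐᵒᵖ] N, ∀ i m, m ∈ ℳ i ↔ e m ∈ 𝒩 i) :
    ∃ e : BaseChange φ M ≃ₗ[Bᵐᵒᵖ] BaseChange φ N,
      ∀ i x, x ∈ gr φ ℬ ℳ i ↔ e x ∈ gr φ ℬ 𝒩 i := by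
  obtain ⟨e, he⟩ := h
  refine exists_equiv (mapHom φ e.toLinearMap) (mapHom φ e.symm.toLinearMap)
    (mapHom_smul _) (fun x => ?_) (fun x => ?_)
    (mapHom_mem fun i m hm => (he i m).1 hm)
    (mapHom_mem fun i m hm => (he i _).2 (by simpa using hm))
  · rw [mapHom_mapHom, LinearEquiv.symm_comp, mapHom_id]
  · rw [mapHom_mapHom, LinearEquiv.comp_symm, mapHom_id]

theorem prod_iso :
    ∃ e : BaseChange φ (M × N) ≃ₗ[Bᵐᵒᵖ] BaseChange φ M × BaseChange φ N,
      ∀ i x, x ∈ gr φ ℬ (fun i => (ℳ i).prod (𝒩 i)) i ↔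
        e x ∈ (gr φ ℬ ℳ i).prod (gr φ ℬ 𝒩 i) := by
  have hfs : LinearMap.inl Aᵐᵒᵖ M N ∘ₗ LinearMap.fst Aᵐᵒᵖ M N +
      LinearMap.inr Aᵐᵒᵖ M N ∘ₗ LinearMap.snd Aᵐᵒᵖ M N = LinearMap.id := by
    ext <;> simp
  let h𝒫 : ℤ → AddSubgroup (M × N) := fun i => (ℳ i).prod (𝒩 i)
  refine exists_equiv (𝒳 := gr φ ℬ h𝒫)
    (𝒴 := fun i => (gr φ ℬ ℳ i).prod (gr φ ℬ 𝒩 i))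
    ((mapHom φ (LinearMap.fst Aᵐᵒᵖ M N)).prod (mapHom φ (LinearMap.snd Aᵐᵒᵖ M N)))
    ((mapHom φ (LinearMap.inl Aᵐᵒᵖ M N)).coprod (mapHom φ (LinearMap.inr Aᵐᵒᵖ M N)))
    (fun c x => Prod.ext (mapHom_smul _ c x) (mapHom_smul _ c x)) (fun x => ?_) (fun x => ?_)
    (fun i x hx => ⟨mapHom_mem (ℳ := h𝒫) (fun i m hm => hm.1) i x hx,
      mapHom_mem (ℳ := h𝒫) (fun i m hm => hm.2) i x hx⟩)
    (fun i x hx => add_mem (mapHom_mem (𝒩 := h𝒫) (fun i m hm => ⟨hm, zero_mem _⟩) i _ hx.1)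
      (mapHom_mem (𝒩 := h𝒫) (fun i m hm => ⟨zero_mem _, hm⟩) i _ hx.2))
  · change mapHom φ _ (mapHom φ _ x) + mapHom φ _ (mapHom φ _ x) = x
    rw [mapHom_mapHom, mapHom_mapHom, ← mapHom_add, hfs, mapHom_id]
  · obtain ⟨x, y⟩ := x
    refine Prod.ext ?_ ?_
    · change mapHom φ (LinearMap.fst Aᵐᵒᵖ M N) (mapHom φ (LinearMap.inl Aᵐᵒᵖ M N) x +
        mapHom φ (LinearMap.inr Aᵐᵒᵖ M N) y) = x
      rw [map_add, mapHom_mapHom, mapHom_mapHom, LinearMap.fst_comp_inl, LinearMap.fst_comp_inr,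
        mapHom_id, mapHom_zero, add_zero]
    · change mapHom φ (LinearMap.snd Aᵐᵒᵖ M N) (mapHom φ (LinearMap.inl Aᵐᵒᵖ M N) x +
        mapHom φ (LinearMap.inr Aᵐᵒᵖ M N) y) = y
      rw [map_add, mapHom_mapHom, mapHom_mapHom, LinearMap.snd_comp_inl, LinearMap.snd_comp_inr,
        mapHom_id, mapHom_zero, zero_add]

theorem eq_zero [Subsingleton M] (x : BaseChange φ M) : x = 0 := by
  induction x using induction with
  | tmul m b => rw [Subsingleton.elim m 0, zero_tmul]
  | add x y hx hy => rw [hx, hy, add_zero]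

theorem comp_iso {C : Type t} [Ring C] {𝒞 : ℤ → AddSubgroup C} [SetLike.GradedMonoid ℬ]
    [SetLike.GradedMonoid 𝒞] {ψ : B →+* C} {χ : A →+* C} (h : ∀ a, ψ (φ a) = χ a)
    (hψ : ∀ {i b}, b ∈ ℬ i → ψ b ∈ 𝒞 i) :
    ∃ e : BaseChange ψ (BaseChange φ M) ≃ₗ[Cᵐᵒᵖ] BaseChange χ M,
      ∀ i x, x ∈ gr ψ 𝒞 (gr φ ℬ ℳ) i ↔ e x ∈ gr χ 𝒞 ℳ i := by
  let f₀ : C → B →+ M →+ BaseChange χ M := fun c =>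
    (tmulHom χ).comp ((AddMonoidHom.mulRight c).comp ψ.toAddMonoidHom)
  have hf₀ : ∀ c a b m, f₀ c (φ a * b) m = f₀ c b (op a • m) := by
    intro c a b m
    change tmul χ m (ψ (φ a * b) * c) = tmul χ (op a • m) (ψ b * c)
    rw [map_mul, h, mul_assoc, tmul_mul]
  let f₁ : C →+ BaseChange φ M →+ BaseChange χ M :=
    AddMonoidHom.mk' (fun c => lift (f₀ c) (hf₀ c)) fun c d => hom_ext fun m b => by
      change tmul χ m (ψ b * (c + d)) = tmul χ m (ψ b * c) + tmul χ m (ψ b * d)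
      rw [mul_add, tmul_add]
  have hf₁ : ∀ b c (x : BaseChange φ M), f₁ (ψ b * c) x = f₁ c (op b • x) := by
    intro b c x
    induction x using BaseChange.induction with
    | tmul m d =>
      rw [smul_tmul]
      change tmul χ m (ψ d * (ψ b * c)) = tmul χ m (ψ (d * b) * c)
      rw [map_mul, mul_assoc]
    | add x y hx hy => rw [smul_add, map_add, map_add, hx, hy]
  let F : BaseChange ψ (BaseChange φ M) →+ BaseChange χ M := lift f₁ hf₁
  let g₀ : C →+ M →+ BaseChange ψ (BaseChange φ M) :=
    (AddMonoidHom.compHom' (AddMonoidHom.mk' (fun m => tmul φ m 1)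
      fun m n => add_tmul _ m n 1)).comp (tmulHom ψ)
  have hg₀ : ∀ a c m, g₀ (χ a * c) m = g₀ c (op a • m) := by
    intro a c m
    change tmul ψ (tmul φ m 1) (χ a * c) = tmul ψ (tmul φ (op a • m) 1) c
    rw [← h, tmul_mul, smul_tmul, one_mul, ← tmul_mul, mul_one]
  let G : BaseChange χ M →+ BaseChange ψ (BaseChange φ M) := lift g₀ hg₀
  have hF : ∀ m b c, F (tmul ψ (tmul φ m b) c) = tmul χ m (ψ b * c) := fun m b c => rfl
  have hG : ∀ m c, G (tmul χ m c) = tmul ψ (tmul φ m 1) c := fun m c => rfl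
  refine exists_equiv F G ?_ ?_ ?_ ?_ ?_
  · refine map_smul_of_tmul F fun x c d => ?_
    induction x using BaseChange.induction with
    | tmul m b => rw [hF, hF, smul_tmul, mul_assoc]
    | add x y hx hy => rw [add_tmul, add_tmul, map_add, map_add, smul_add, hx, hy]
  · intro x
    induction x using BaseChange.induction with
    | add x y hx hy => rw [map_add, map_add, hx, hy]
    | tmul x c =>
    induction x using BaseChange.induction with
    | add x y hx hy => rw [add_tmul, map_add, map_add, hx, hy]
    | tmul m b => rw [hF, hG, tmul_mul, smul_tmul, one_mul]
  · intro x
    induction x using BaseChange.induction with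
    | add x y hx hy => rw [map_add, map_add, hx, hy]
    | tmul m c => rw [hG, hF, map_one, one_mul]
  · intro i x hx
    refine map_mem_of_tmul F (fun i j x hx c hc => ?_) hx
    refine map_mem_of_tmul (f₁ c) (𝒳 := fun n => gr χ 𝒞 ℳ (n + j)) (fun i k m hm b hb => ?_) hx
    change tmul χ m (ψ b * c) ∈ gr χ 𝒞 ℳ (i + k + j)
    rw [add_assoc]
    exact tmul_mem hm (SetLike.mul_mem_graded (hψ hb) hc)
  · intro i x hx
    refine map_mem_of_tmul G (fun i j m hm c hc => ?_) hx
    have h1 : tmul φ m 1 ∈ gr φ ℬ ℳ (i + 0) := tmul_mem hm SetLike.GradedOne.one_mem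
    rw [add_zero] at h1
    rw [hG]
    exact tmul_mem h1 hc

end Iso

end BaseChange

end BaseChange

namespace GrProj

variable {A : Type u} [Ring A] {𝒜 : ℤ → AddSubgroup A}

/-- Two graded modules are isomorphic when there is a linear isomorphism between them that matches
the components of each degree. -/
def Iso (M : GrProj.{u, w₁} 𝒜) (N : GrProj.{u, w₂} 𝒜) : Prop :=
  ∃ e : M.carrier ≃ₗ[Aᵐᵒᵖ] N.carrier, ∀ i m, m ∈ M.gr i ↔ e m ∈ N.gr i

theorem Iso.refl (M : GrProj.{u, w} 𝒜) : Iso M M := ⟨LinearEquiv.refl _ _, fun _ _ => Iff.rfl⟩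

theorem Iso.symm {M : GrProj.{u, w₁} 𝒜} {N : GrProj.{u, w₂} 𝒜} : Iso M N → Iso N M := by
  rintro ⟨e, he⟩
  exact ⟨e.symm, fun i n => by rw [he, e.apply_symm_apply]⟩

theorem Iso.trans {M : GrProj.{u, w₁} 𝒜} {N : GrProj.{u, w₂} 𝒜} {P : GrProj.{u, w₃} 𝒜} :
    Iso M N → Iso N P → Iso M P := by
  rintro ⟨e, he⟩ ⟨f, hf⟩
  exact ⟨e.trans f, fun i m => by rw [he, hf, e.trans_apply]⟩

variable (𝒜) in
/-- Isomorphism of graded modules as an equivalence relation. -/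
def isoSetoid : Setoid (GrProj.{u, w} 𝒜) := ⟨Iso, Iso.refl, Iso.symm, Iso.trans⟩

/-- The direct sum of graded modules. -/
def prod (M : GrProj.{u, w₁} 𝒜) (N : GrProj.{u, w₂} 𝒜) : GrProj.{u, max w₁ w₂} 𝒜 where
  carrier := M.carrier × N.carrier
  gr i := (M.gr i).prod (N.gr i)
  isInternal := by
    refine isInternal_of_split
      (((Finsupp.mapRange.addMonoidHom (AddMonoidHom.inl M.carrier N.carrier)).comp
          (split M.isInternal)).comp (AddMonoidHom.fst _ _) +
        ((Finsupp.mapRange.addMonoidHom (AddMonoidHom.inr M.carrier N.carrier)).comp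
          (split N.isInternal)).comp (AddMonoidHom.snd _ _)) ?_ ?_
    · rintro i ⟨m, n⟩ ⟨hm, hn⟩
      simp only [AddMonoidHom.add_apply, AddMonoidHom.comp_apply, AddMonoidHom.coe_fst,
        AddMonoidHom.coe_snd]
      rw [split_of_mem M.isInternal hm, split_of_mem N.isInternal hn]
      simp [← Finsupp.single_add]
    · rintro ⟨m, n⟩
      have h1 : (m, (0 : N.carrier)) ∈ ⨆ i, (M.gr i).prod (N.gr i) := by
        induction m using hom_induction M.isInternal with
        | hom i m hm => exact AddSubgroup.mem_iSup_of_mem i ⟨hm, zero_mem _⟩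
        | add x y hx hy => simpa using add_mem hx hy
      have h2 : ((0 : M.carrier), n) ∈ ⨆ i, (M.gr i).prod (N.gr i) := by
        induction n using hom_induction N.isInternal with
        | hom i n hn => exact AddSubgroup.mem_iSup_of_mem i ⟨zero_mem _, hn⟩
        | add x y hx hy => simpa using add_mem hx hy
      simpa using add_mem h1 h2
  smul_mem := fun hm ha => ⟨M.smul_mem hm.1 ha, N.smul_mem hm.2 ha⟩

theorem Iso.prod {M M' : GrProj.{u, w₁} 𝒜} {N N' : GrProj.{u, w₂} 𝒜} :
    Iso M M' → Iso N N' → Iso (M.prod N) (M'.prod N') := by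
  rintro ⟨e, he⟩ ⟨f, hf⟩
  exact ⟨e.prodCongr f, fun i m => and_congr (he i m.1) (hf i m.2)⟩

variable (𝒜) in
/-- The zero graded module. -/
def zero : GrProj.{u, w} 𝒜 where
  carrier := PUnit
  gr _ := ⊤
  isInternal := isInternal_of_split 0 (fun _ _ _ => by ext)
    fun _ => AddSubgroup.mem_iSup_of_mem 0 trivial
  smul_mem := fun _ _ => trivial

variable {B : Type v} [Ring B] {ℬ : ℤ → AddSubgroup B} {C : Type t} [Ring C]
  {𝒞 : ℤ → AddSubgroup C} [GradedRing 𝒜] [GradedRing ℬ] [GradedRing 𝒞]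

/-- Extension of scalars of graded modules along a homomorphism of graded rings. -/
noncomputable def baseChange (φ : 𝒜 →+*ᵍ ℬ) (M : GrProj.{u, w} 𝒜) : GrProj.{v, max v w} ℬ where
  carrier := BaseChange φ.toRingHom M.carrier
  gr := BaseChange.gr φ.toRingHom ℬ M.gr
  isInternal := BaseChange.isInternal (𝒜 := 𝒜) (fun h => φ.map_mem h) M.isInternal M.smul_mem
  smul_mem := BaseChange.smul_mem

theorem Iso.baseChange (φ : 𝒜 →+*ᵍ ℬ) {M : GrProj.{u, w₁} 𝒜} {N : GrProj.{u, w₂} 𝒜}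
    (h : Iso M N) : Iso (M.baseChange φ) (N.baseChange φ) :=
  BaseChange.congr_iso h

theorem baseChange_zero (φ : 𝒜 →+*ᵍ ℬ) :
    Iso ((zero.{u, w₁} 𝒜).baseChange φ) (zero.{v, w₂} ℬ) :=
  BaseChange.exists_equiv (X := BaseChange φ.toRingHom PUnit) (Y := PUnit) 0 0 (fun _ _ => rfl)
    (fun x => (BaseChange.eq_zero x).symm) (fun _ => rfl) (fun _ _ _ => trivial)
    (fun _ _ _ => zero_mem _)

theorem baseChange_prod (φ : 𝒜 →+*ᵍ ℬ) (M : GrProj.{u, w₁} 𝒜) (N : GrProj.{u, w₂} 𝒜) :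
    Iso ((M.prod N).baseChange φ) ((M.baseChange φ).prod (N.baseChange φ)) :=
  BaseChange.prod_iso

theorem baseChange_comp (φ : 𝒜 →+*ᵍ ℬ) (ψ : ℬ →+*ᵍ 𝒞) (χ : 𝒜 →+*ᵍ 𝒞)
    (h : ∀ a, ψ (φ a) = χ a) (M : GrProj.{u, w} 𝒜) :
    Iso ((M.baseChange φ).baseChange ψ) (M.baseChange χ) :=
  BaseChange.comp_iso h fun hb => ψ.map_mem hb

end GrProj

/-! ### Graded `K₀` of unital rings -/

section Unital

variable {A : Type u} [Ring A] (𝒜 : ℤ → AddSubgroup A)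

/-- The isomorphism classes of finitely generated projective graded right modules. -/
def IsoClass : Type (max u (w + 1)) := Quotient (GrProj.isoSetoid.{u, w} 𝒜)

namespace IsoClass

variable {𝒜} in
/-- The isomorphism class of a module. -/
def mk (M : GrProj.{u, w} 𝒜) : IsoClass.{u, w} 𝒜 := Quotient.mk _ M

instance : Add (IsoClass.{u, w} 𝒜) :=
  ⟨Quotient.map₂ GrProj.prod fun _ _ h _ _ h' => GrProj.Iso.prod h h'⟩

instance : Zero (IsoClass.{u, w} 𝒜) := ⟨mk (GrProj.zero 𝒜)⟩

theorem zero_add (x : IsoClass.{u, w} 𝒜) : 0 + x = x := by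
  obtain ⟨M⟩ := x
  exact Quotient.sound ⟨LinearEquiv.uniqueProd (R := Aᵐᵒᵖ) (M := M.carrier) (M₂ := PUnit.{w + 1}),
    fun i m => and_iff_right trivial⟩

theorem add_comm (x y : IsoClass.{u, w} 𝒜) : x + y = y + x := by
  obtain ⟨M⟩ := x
  obtain ⟨N⟩ := y
  exact Quotient.sound ⟨LinearEquiv.prodComm Aᵐᵒᵖ M.carrier N.carrier, fun i m => and_comm⟩

theorem add_assoc (x y z : IsoClass.{u, w} 𝒜) : x + y + z = x + (y + z) := by
  obtain ⟨M⟩ := x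
  obtain ⟨N⟩ := y
  obtain ⟨P⟩ := z
  exact Quotient.sound ⟨LinearEquiv.prodAssoc Aᵐᵒᵖ M.carrier N.carrier P.carrier,
    fun i m => and_assoc⟩

/-- Isomorphism classes form a commutative monoid under the direct sum. -/
instance : AddCommMonoid (IsoClass.{u, w} 𝒜) where
  add_assoc := add_assoc 𝒜
  zero_add := zero_add 𝒜
  add_zero x := (add_comm 𝒜 x 0).trans (zero_add 𝒜 x)
  add_comm := add_comm 𝒜
  nsmul := nsmulRec

variable {𝒜} {B : Type v} [Ring B] {ℬ : ℤ → AddSubgroup B} [GradedRing 𝒜] [GradedRing ℬ]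

/-- The homomorphism induced by extension of scalars. -/
noncomputable def map (φ : 𝒜 →+*ᵍ ℬ) : IsoClass.{u, w} 𝒜 →+ IsoClass.{v, max v w} ℬ where
  toFun := Quotient.map (GrProj.baseChange φ) fun _ _ h => GrProj.Iso.baseChange φ h
  map_zero' := Quotient.sound (GrProj.baseChange_zero φ)
  map_add' := by
    rintro ⟨M⟩ ⟨N⟩
    exact Quotient.sound (GrProj.baseChange_prod φ M N)

end IsoClass

open Algebra

/-- The group `K₀` of the split-exact category of finitely generated projective graded right
`A`-modules in `Type w`, that is, the group completion of the monoid of isomorphism classes. -/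
abbrev K0 : Type (max u (w + 1)) := GrothendieckAddGroup (IsoClass.{u, w} 𝒜)

variable {𝒜} {B : Type v} [Ring B] {ℬ : ℤ → AddSubgroup B} {C : Type t} [Ring C]
  {𝒞 : ℤ → AddSubgroup C} [GradedRing 𝒜] [GradedRing ℬ] [GradedRing 𝒞]

/-- The homomorphism between graded `K₀`-groups induced by a homomorphism of graded unital
rings. -/
noncomputable def K0.map (φ : 𝒜 →+*ᵍ ℬ) : K0.{u, w} 𝒜 →+ K0.{v, max v w} ℬ :=
  GrothendieckAddGroup.lift (GrothendieckAddGroup.of.comp (IsoClass.map φ))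

/-- The class of a module in `K₀`. -/
noncomputable def K0.of (M : GrProj.{u, w} 𝒜) : K0.{u, w} 𝒜 :=
  GrothendieckAddGroup.of (IsoClass.mk M)

theorem K0.map_of (φ : 𝒜 →+*ᵍ ℬ) (M : GrProj.{u, w} 𝒜) :
    K0.map φ (K0.of M) = K0.of (M.baseChange φ) :=
  DFunLike.congr_fun (GrothendieckAddGroup.lift.symm_apply_apply
    (GrothendieckAddGroup.of.comp (IsoClass.map φ))) (IsoClass.mk M)

theorem K0.map_comp (φ : 𝒜 →+*ᵍ ℬ) (ψ : ℬ →+*ᵍ 𝒞) (χ : 𝒜 →+*ᵍ 𝒞) (h : ∀ a, ψ (φ a) = χ a)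
    (x : K0.{u, max v w} 𝒜) :
    K0.map.{v, t, max v w} ψ (K0.map.{u, v, max v w} φ x) = K0.map.{u, t, max v w} χ x := by
  suffices h : (K0.map.{v, t, max v w} ψ).comp (K0.map.{u, v, max v w} φ) =
      K0.map.{u, t, max v w} χ from DFunLike.congr_fun h x
  apply GrothendieckAddGroup.lift.symm.injective
  refine DFunLike.ext _ _ ?_
  rintro ⟨M⟩
  change K0.map.{v, t, max v w} ψ (K0.map.{u, v, max v w} φ (K0.of M)) =
    K0.map.{u, t, max v w} χ (K0.of M)
  rw [K0.map_of, K0.map_of, K0.map_of]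
  exact congrArg GrothendieckAddGroup.of (Quotient.sound (GrProj.baseChange_comp φ ψ χ h M))

end Unital

/-! ### Graded `K₀` of rings that need not have a unit -/

section NonUnital

/-- The ring of integers, concentrated in degree zero. -/
def intGr (n : ℤ) : AddSubgroup ℤ := if n = 0 then ⊤ else ⊥

theorem mem_intGr_zero (k : ℤ) : k ∈ intGr 0 := by simp [intGr]

theorem mem_intGr_of_ne {n : ℤ} (hn : n ≠ 0) {k : ℤ} : k ∈ intGr n ↔ k = 0 := by
  simp [intGr, hn]

theorem intGr_isInternal : DirectSum.IsInternal intGr := by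
  refine isInternal_of_split (Finsupp.singleAddHom 0) (fun n k hk => ?_)
    fun k => AddSubgroup.mem_iSup_of_mem 0 (mem_intGr_zero k)
  by_cases hn : n = 0
  · rw [hn]; rfl
  · rw [mem_intGr_of_ne hn] at hk
    simp [hk]

instance : SetLike.GradedMonoid intGr where
  one_mem := mem_intGr_zero 1
  mul_mem := by
    intro i j x y hx hy
    by_cases hi : i = 0
    · by_cases hj : j = 0
      · subst hi hj; exact mem_intGr_zero _
      · rw [(mem_intGr_of_ne hj).1 hy, mul_zero]; exact zero_mem _
    · rw [(mem_intGr_of_ne hi).1 hx, zero_mul]; exact zero_mem _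

noncomputable instance : GradedRing intGr :=
  { intGr_isInternal.chooseDecomposition with }

/-- The unitalization `ℤ ⊕ A` of a ring `A` which need not have a unit. -/
def ZUnit (A : Type u) [NonUnitalRing A] : Type u := Unitization ℤ A

namespace ZUnit

variable {A : Type u} [NonUnitalRing A]

instance : Ring (ZUnit A) := inferInstanceAs (Ring (Unitization ℤ A))

/-- The projection `ℤ ⊕ A → ℤ`. -/
def fst : ZUnit A →+* ℤ := (Unitization.fstHom ℤ A).toRingHom

/-- The second component of an element of `ℤ ⊕ A`. -/
def snd : ZUnit A →+ A := AddMonoidHom.mk' (fun x : Unitization ℤ A => x.toProd.2) fun _ _ => rfl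

/-- The inclusion of `A`. -/
def inr : A →+ ZUnit A :=
  AddMonoidHom.mk' (fun a => (Unitization.inr a : Unitization ℤ A))
    fun a b => Unitization.inr_add ℤ a b

/-- The element `(k, a)` of `ℤ ⊕ A`. -/
def mk (k : ℤ) (a : A) : ZUnit A := Unitization.mk (k, a)

theorem ext {x y : ZUnit A} (h1 : fst x = fst y) (h2 : snd x = snd y) : x = y :=
  Unitization.ext h1 h2

@[simp] theorem fst_mk (k : ℤ) (a : A) : fst (mk k a) = k := rfl

@[simp] theorem snd_mk (k : ℤ) (a : A) : snd (mk k a) = a := rfl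

@[simp] theorem fst_inr (a : A) : fst (inr a) = 0 := rfl

@[simp] theorem snd_inr (a : A) : snd (inr a) = a := rfl

@[simp] theorem snd_one : snd (1 : ZUnit A) = 0 := rfl

theorem snd_mul (x y : ZUnit A) :
    snd (x * y) = fst x • snd y + fst y • snd x + snd x * snd y := rfl

end ZUnit

variable {A : Type u} [NonUnitalRing A] {σ : Type*} [SetLike σ A] [AddSubgroupClass σ A]
  (𝒜 : ℤ → σ) {B : Type v} [NonUnitalRing B] {τ : Type*} [SetLike τ B] [AddSubgroupClass τ B]
  (ℬ : ℤ → τ)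

/-- The grading of the unitalization `ℤ ⊕ A`: the component of degree `0` is `ℤ ⊕ A₀` and the
component of degree `n ≠ 0` is `Aₙ`. -/
def unitGr (n : ℤ) : AddSubgroup (ZUnit A) where
  carrier := {x | x.fst ∈ intGr n ∧ x.snd ∈ 𝒜 n}
  zero_mem' := ⟨zero_mem _, zero_mem _⟩
  add_mem' := fun hx hy => ⟨add_mem hx.1 hy.1, add_mem hx.2 hy.2⟩
  neg_mem' := fun {x} hx => by
    refine ⟨by rw [map_neg]; exact neg_mem hx.1, by rw [map_neg]; exact neg_mem hx.2⟩

theorem unitGr_isInternal [DirectSum.Decomposition 𝒜] :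
    DirectSum.IsInternal (unitGr 𝒜) := by
  let s : A →+ (ℤ →₀ A) :=
    (DirectSum.toAddMonoid fun i => (Finsupp.singleAddHom i).comp
      (AddSubmonoidClass.subtype (𝒜 i))).comp (DirectSum.decomposeAddEquiv 𝒜).toAddMonoidHom
  have hs : ∀ i, ∀ a ∈ 𝒜 i, s a = Finsupp.single i a := by
    intro i a ha
    simp [s, DirectSum.decompose_of_mem 𝒜 ha]
  let c : ℤ →+ ZUnit A := (Int.castRingHom (ZUnit A)).toAddMonoidHom
  have hc : ∀ x : ZUnit A, c x.fst + ZUnit.inr x.snd = x := fun x =>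
    ZUnit.ext (by simp [c]) (by
      have : ∀ k : ℤ, ZUnit.snd (k : ZUnit A) = 0 := fun k => by
        rw [← zsmul_one, map_zsmul, ZUnit.snd_one, smul_zero]
      simp [c, this])
  let δ : ZUnit A →+ (ℤ →₀ ZUnit A) :=
    ((Finsupp.singleAddHom 0).comp c).comp ZUnit.fst.toAddMonoidHom +
      ((Finsupp.mapRange.addMonoidHom ZUnit.inr).comp s).comp ZUnit.snd
  refine isInternal_of_split δ (fun n x hx => ?_) fun x => ?_
  · have h1 : δ x = Finsupp.single 0 (c x.fst) +
      Finsupp.mapRange.addMonoidHom ZUnit.inr (s x.snd) := rfl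
    have h2 : Finsupp.single 0 (c x.fst) = Finsupp.single n (c x.fst) := by
      by_cases hn : n = 0
      · rw [hn]
      · rw [(mem_intGr_of_ne hn).1 hx.1]; simp
    rw [h1, h2, hs n _ hx.2]
    simp only [Finsupp.mapRange.addMonoidHom_apply, Finsupp.mapRange_single]
    rw [← Finsupp.single_add, hc]
  · have h1 : c x.fst ∈ ⨆ n, unitGr 𝒜 n :=
      AddSubgroup.mem_iSup_of_mem 0 <| by
        have : c x.fst = x.fst • (1 : ZUnit A) := by simp [c]
        rw [this]
        have h0 : (1 : ZUnit A) ∈ unitGr 𝒜 0 := ⟨mem_intGr_zero _, zero_mem _⟩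
        exact zsmul_mem h0 _
    have h2 : ∀ a : A, ZUnit.inr a ∈ ⨆ n, unitGr 𝒜 n := by
      intro a
      induction a using DirectSum.Decomposition.inductionOn 𝒜 with
      | zero => rw [map_zero]; exact zero_mem _
      | homogeneous a => exact AddSubgroup.mem_iSup_of_mem _ ⟨zero_mem _, a.2⟩
      | add a b ha hb => rw [map_add]; exact add_mem ha hb
    rw [← hc x]
    exact add_mem h1 (h2 _)

instance [SetLike.GradedMul 𝒜] : SetLike.GradedMonoid (unitGr 𝒜) where
  one_mem := ⟨mem_intGr_zero 1, zero_mem _⟩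
  mul_mem := by
    intro i j x y hx hy
    refine ⟨by rw [map_mul]; exact SetLike.mul_mem_graded hx.1 hy.1, ?_⟩
    rw [ZUnit.snd_mul]
    refine add_mem (add_mem ?_ ?_) (SetLike.GradedMul.mul_mem hx.2 hy.2)
    · by_cases hi : i = 0
      · subst hi; rw [zero_add]; exact zsmul_mem hy.2 _
      · rw [(mem_intGr_of_ne hi).1 hx.1, zero_smul]; exact zero_mem _
    · by_cases hj : j = 0
      · subst hj; rw [add_zero]; exact zsmul_mem hx.2 _
      · rw [(mem_intGr_of_ne hj).1 hy.1, zero_smul]; exact zero_mem _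

noncomputable instance [SetLike.GradedMul 𝒜] [DirectSum.Decomposition 𝒜] :
    GradedRing (unitGr 𝒜) :=
  { (unitGr_isInternal 𝒜).chooseDecomposition with }

/-- The projection `ℤ ⊕ A → ℤ`, as a homomorphism of graded rings. -/
def unitFst : unitGr 𝒜 →+*ᵍ intGr where
  toRingHom := ZUnit.fst
  map_mem hx := hx.1

variable {𝒜 ℬ}

/-- The homomorphism `(k, a) ↦ (k, f a)` of unitalizations. -/
def unitMap (f : A →ₙ+* B) (hf : ∀ n, ∀ a ∈ 𝒜 n, f a ∈ ℬ n) : unitGr 𝒜 →+*ᵍ unitGr ℬ where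
  toFun x := ZUnit.mk x.fst (f x.snd)
  map_one' := ZUnit.ext (by simp) (by simp)
  map_mul' x y := ZUnit.ext (by simp) (by simp [ZUnit.snd_mul])
  map_zero' := ZUnit.ext (by simp) (by simp)
  map_add' x y := ZUnit.ext (by simp) (by simp)
  map_mem {n x} hx := by
    change ZUnit.fst (ZUnit.mk _ _) ∈ intGr n ∧ ZUnit.snd (ZUnit.mk _ _) ∈ ℬ n
    rw [ZUnit.fst_mk, ZUnit.snd_mk]
    exact ⟨hx.1, hf n _ hx.2⟩

theorem unitFst_unitMap (f : A →ₙ+* B) (hf : ∀ n, ∀ a ∈ 𝒜 n, f a ∈ ℬ n) (x : ZUnit A) :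
    unitFst ℬ (unitMap f hf x) = unitFst 𝒜 x :=
  ZUnit.fst_mk _ _

variable [SetLike.GradedMul 𝒜] [DirectSum.Decomposition 𝒜]
  [SetLike.GradedMul ℬ] [DirectSum.Decomposition ℬ]

variable (𝒜) in
/-- The graded Grothendieck group `K₀^gr(A)` of a graded ring `A` which need not have a unit: the
kernel of the map `K₀^gr(ℤ ⊕ A) → K₀^gr(ℤ)` induced by the projection. The modules are taken in
`Type (max u w)`. -/
noncomputable def K0gr : AddSubgroup (K0.{u, max u w} (unitGr 𝒜)) :=
  (K0.map.{u, 0, max u w} (unitFst 𝒜)).ker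

theorem map_unitMap_mem (f : A →ₙ+* B) (hf : ∀ n, ∀ a ∈ 𝒜 n, f a ∈ ℬ n)
    (x : K0.{u, max u v} (unitGr 𝒜)) (hx : x ∈ K0gr.{u, v} 𝒜) :
    K0.map.{u, v, max u v} (unitMap f hf) x ∈ K0gr.{v, u} ℬ := by
  have h := K0.map_comp.{u, v, max u v, 0} (unitMap f hf) (unitFst ℬ)
    (unitFst 𝒜) (unitFst_unitMap f hf) x
  rw [K0gr, AddMonoidHom.mem_ker] at hx ⊢
  exact h.trans hx

/-- The homomorphism `K₀^gr(f) : K₀^gr(A) → K₀^gr(B)` induced by a homomorphism `f` of graded rings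
which need not preserve units. On both sides the modules are taken in `Type (max u v)`. -/
noncomputable def K0gr.map (f : A →ₙ+* B) (hf : ∀ n, ∀ a ∈ 𝒜 n, f a ∈ ℬ n) :
    K0gr.{u, v} 𝒜 →+ K0gr.{v, u} ℬ :=
  ((K0.map.{u, v, max u v} (unitMap f hf)).comp (K0gr.{u, v} 𝒜).subtype).codRestrict
    (K0gr.{v, u} ℬ) fun x => map_unitMap_mem f hf x.1 x.2

end NonUnital

end GradedK

/-! Suppose `f` is not injective. Its kernel is a graded ideal, and a graded ideal that is not zero
contains a non-zero vertex `v` (`exists_vertex_of_not_injective`): from a homogeneous element,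
multiply on the left by ghost edges and on the right by edges until a non-zero multiple of a vertex
is left. The graded right ideal `Q` generated by `v` becomes zero after extension of scalars along
`f`, and also along the projection to `ℤ`, so it has a class in the kernel defining `K0gr`, and
injectivity on `K0gr` forces this class to be zero (`K0gr.of_ofIdempotent_eq_zero`). It remains to
see that it is not zero (`K0_of_vertex_ne_zero`).

If the class vanished, there would be a graded isomorphism `Q ⊕ P ≅ P` with `P` finitely generated,
hence an injective endomorphism of `P` of degree zero whose image misses the generator of `Q`.
Without gradings this can happen: the Leavitt algebra with `L ≅ L ⊕ L` has trivial `K₀`. The grading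
excludes it by finiteness. The monomials of fixed degree with a bounded number of edges span a
finite-dimensional space, and `mul_mem_filtration` bounds the number of edges in a product so
sharply that the homogeneous matrix of a degree-zero endomorphism preserves suitable
finite-dimensional spaces of coefficient columns. Injective endomorphisms of finite-dimensional
spaces are surjective; applied modulo the relations among the generators
(`exists_sub_mem_of_invariant`), this makes the endomorphism surjective on the homogeneous elements
of the part of `P` on which the unit of `L(E)` acts as the identity (`exists_eq_of_injective`), and
that part contains the image of the generator of `Q`. -/

namespace DirectedGraph.LeavittPathAlgebra

/-! ### Monomials in the Leavitt path algebra and the filtration by the number of edges. -/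

section Monomials

variable {ℓ : Type*} [CommRing ℓ] {E : DirectedGraph} [Fintype E.Vertex] [Fintype E.Edge]

theorem vertex_mul_self (v : E.Vertex) :
    gen ℓ E (.vertex v) * gen ℓ E (.vertex v) = gen ℓ E (.vertex v) := by
  simpa only [gen, map_mul] using mk_rel (LeavittRel.vertex_mul_self (ℓ := ℓ) v)

theorem vertex_mul_of_ne {v w : E.Vertex} (h : v ≠ w) :
    gen ℓ E (.vertex v) * gen ℓ E (.vertex w) = 0 := by
  simpa only [gen, map_mul, map_zero] using mk_rel (LeavittRel.vertex_mul_of_ne (ℓ := ℓ) v w h)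

theorem source_mul_edge (e : E.Edge) :
    gen ℓ E (.vertex (E.source e)) * gen ℓ E (.edge e) = gen ℓ E (.edge e) := by
  simpa only [gen, map_mul] using mk_rel (LeavittRel.source_mul_edge (ℓ := ℓ) e)

theorem edge_mul_range (e : E.Edge) :
    gen ℓ E (.edge e) * gen ℓ E (.vertex (E.range e)) = gen ℓ E (.edge e) := by
  simpa only [gen, map_mul] using mk_rel (LeavittRel.edge_mul_range (ℓ := ℓ) e)

theorem range_mul_ghost (e : E.Edge) :
    gen ℓ E (.vertex (E.range e)) * gen ℓ E (.ghost e) = gen ℓ E (.ghost e) := by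
  simpa only [gen, map_mul] using mk_rel (LeavittRel.range_mul_ghost (ℓ := ℓ) e)

theorem ghost_mul_source (e : E.Edge) :
    gen ℓ E (.ghost e) * gen ℓ E (.vertex (E.source e)) = gen ℓ E (.ghost e) := by
  simpa only [gen, map_mul] using mk_rel (LeavittRel.ghost_mul_source (ℓ := ℓ) e)

theorem ghost_mul_edge_self (e : E.Edge) :
    gen ℓ E (.ghost e) * gen ℓ E (.edge e) = gen ℓ E (.vertex (E.range e)) := by
  simpa only [gen, map_mul] using mk_rel (LeavittRel.ghost_mul_edge_self (ℓ := ℓ) e)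

theorem ghost_mul_edge_of_ne {e f : E.Edge} (h : e ≠ f) :
    gen ℓ E (.ghost e) * gen ℓ E (.edge f) = 0 := by
  simpa only [gen, map_mul, map_zero] using mk_rel (LeavittRel.ghost_mul_edge_of_ne (ℓ := ℓ) e f h)

open Classical in
theorem sum_edge_mul_ghost {v : E.Vertex} (h : ∃ e, E.source e = v) :
    ∑ e : E.Edge with E.source e = v, gen ℓ E (.edge e) * gen ℓ E (.ghost e) =
      gen ℓ E (.vertex v) := by
  simpa only [gen, map_mul, map_sum] using mk_rel (LeavittRel.sum_edge_mul_ghost (ℓ := ℓ) v h)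

variable (ℓ E) in
theorem sum_vertex : ∑ v : E.Vertex, gen ℓ E (.vertex v) = 1 := by
  simpa only [gen, map_one, map_sum] using mk_rel (LeavittRel.sum_vertex (ℓ := ℓ) (E := E))

theorem vertex_mul_edge_of_ne {v : E.Vertex} {e : E.Edge} (h : v ≠ E.source e) :
    gen ℓ E (.vertex v) * gen ℓ E (.edge e) = 0 := by
  rw [← source_mul_edge, ← mul_assoc, vertex_mul_of_ne h, zero_mul]

theorem ghost_mul_vertex_of_ne {v : E.Vertex} {e : E.Edge} (h : E.source e ≠ v) :
    gen ℓ E (.ghost e) * gen ℓ E (.vertex v) = 0 := by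
  rw [← ghost_mul_source, mul_assoc, vertex_mul_of_ne h, mul_zero]

variable (ℓ E) in
/-- The product of the edges in a list. -/
noncomputable def edgeProd (α : List E.Edge) : E.LeavittPathAlgebra ℓ :=
  (α.map fun e => gen ℓ E (.edge e)).prod

variable (ℓ E) in
/-- The product of the ghost edges in a list. -/
noncomputable def ghostProd (β : List E.Edge) : E.LeavittPathAlgebra ℓ :=
  (β.map fun e => gen ℓ E (.ghost e)).prod

variable (ℓ E) in
/-- The monomial formed by a word of edges, a vertex and a word of ghost edges. -/
noncomputable def monomial (α : List E.Edge) (v : E.Vertex) (β : List E.Edge) :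
    E.LeavittPathAlgebra ℓ :=
  edgeProd ℓ E α * (gen ℓ E (.vertex v) * ghostProd ℓ E β)

theorem monomial_nil (v : E.Vertex) (β : List E.Edge) :
    monomial ℓ E [] v β = gen ℓ E (.vertex v) * ghostProd ℓ E β := by
  simp [monomial, edgeProd]

theorem monomial_cons (e : E.Edge) (α : List E.Edge) (v : E.Vertex) (β : List E.Edge) :
    monomial ℓ E (e :: α) v β = gen ℓ E (.edge e) * monomial ℓ E α v β := by
  simp [monomial, edgeProd, mul_assoc]

variable (ℓ E) in
/-- The span of the monomials of degree `k` with at most `n` edges. -/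
noncomputable def filtration (n k : ℤ) : Submodule ℓ (E.LeavittPathAlgebra ℓ) :=
  Submodule.span ℓ {x | ∃ α v β, (α.length : ℤ) ≤ n ∧ (α.length : ℤ) - β.length = k ∧
    monomial ℓ E α v β = x}

theorem monomial_mem {α β : List E.Edge} (v : E.Vertex) {n k : ℤ} (hn : (α.length : ℤ) ≤ n)
    (hk : (α.length : ℤ) - β.length = k) : monomial ℓ E α v β ∈ filtration ℓ E n k :=
  Submodule.subset_span ⟨α, v, β, hn, hk, rfl⟩

theorem filtration_mono {n n' : ℤ} (k : ℤ) (h : n ≤ n') :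
    filtration ℓ E n k ≤ filtration ℓ E n' k :=
  Submodule.span_mono fun _ ⟨α, v, β, hn, hk, hx⟩ => ⟨α, v, β, hn.trans h, hk, hx⟩

/-- Once the degree is fixed, a bound on the number of edges also bounds the number of ghost edges,
by `n - k`, so only finitely many monomials occur. They may vanish or be linearly dependent; only
that they span is ever used. -/
instance finite_filtration (n k : ℤ) : Module.Finite ℓ (filtration ℓ E n k) := by
  refine Module.Finite.span_of_finite ℓ (Set.Finite.subset (Set.Finite.image
    (fun p : List E.Edge × E.Vertex × List E.Edge => monomial ℓ E p.1 p.2.1 p.2.2)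
    ((List.finite_length_le E.Edge n.toNat).prod (Set.finite_univ.prod
      (List.finite_length_le E.Edge (n - k).toNat)))) ?_)
  rintro _ ⟨α, v, β, hn, hk, rfl⟩
  exact ⟨(α, v, β), ⟨show α.length ≤ n.toNat by omega, trivial,
    show β.length ≤ (n - k).toNat by omega⟩, rfl⟩

/-- Left multiplication maps a piece of the filtration into a submodule when it does so on
monomials. -/
theorem mul_mem_of_monomial {n k : ℤ} {S : Submodule ℓ (E.LeavittPathAlgebra ℓ)}
    {a x : E.LeavittPathAlgebra ℓ} (hx : x ∈ filtration ℓ E n k)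
    (h : ∀ α v β, (α.length : ℤ) ≤ n → (α.length : ℤ) - β.length = k →
      a * monomial ℓ E α v β ∈ S) : a * x ∈ S := by
  have : filtration ℓ E n k ≤ S.comap (LinearMap.mulLeft ℓ a) := by
    rw [filtration, Submodule.span_le]
    rintro _ ⟨α, v, β, hn, hk, rfl⟩
    exact h α v β hn hk
  exact this hx

theorem vertex_mul_mem (w : E.Vertex) {n k : ℤ} {x : E.LeavittPathAlgebra ℓ}
    (hx : x ∈ filtration ℓ E n k) : gen ℓ E (.vertex w) * x ∈ filtration ℓ E n k := by
  refine mul_mem_of_monomial hx fun α v β hn hk => ?_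
  match α, hn, hk with
  | [], hn, hk =>
    rw [monomial_nil, ← mul_assoc]
    by_cases h : w = v
    · rw [h, vertex_mul_self, ← monomial_nil]
      exact monomial_mem v hn hk
    · rw [vertex_mul_of_ne h, zero_mul]
      exact zero_mem _
  | e :: α, hn, hk =>
    rw [monomial_cons, ← mul_assoc]
    by_cases h : w = E.source e
    · rw [h, source_mul_edge, ← monomial_cons]
      exact monomial_mem v hn hk
    · rw [vertex_mul_edge_of_ne h, zero_mul]
      exact zero_mem _

theorem edge_mul_mem (e : E.Edge) {n k : ℤ} {x : E.LeavittPathAlgebra ℓ}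
    (hx : x ∈ filtration ℓ E n k) : gen ℓ E (.edge e) * x ∈ filtration ℓ E (n + 1) (k + 1) := by
  refine mul_mem_of_monomial hx fun α v β hn hk => ?_
  rw [← monomial_cons]
  exact monomial_mem v (by simpa using hn) (by rw [List.length_cons]; push_cast; omega)

/-- A ghost edge cancels the first edge of a monomial or kills the monomial; if there are no edges,
it either joins the ghost word or kills the monomial. The truncation at `0` accounts for that last
case. -/
theorem ghost_mul_mem (e : E.Edge) {n k : ℤ} {x : E.LeavittPathAlgebra ℓ}
    (hx : x ∈ filtration ℓ E n k) :
    gen ℓ E (.ghost e) * x ∈ filtration ℓ E (max (n - 1) 0) (k - 1) := by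
  refine mul_mem_of_monomial hx fun α v β hn hk => ?_
  match α, hn, hk with
  | [], hn, hk =>
    rw [monomial_nil, ← mul_assoc]
    by_cases h : E.source e = v
    · have : gen ℓ E (.ghost e) * ghostProd ℓ E β = ghostProd ℓ E (e :: β) := by simp [ghostProd]
      rw [← h, ghost_mul_source, ← range_mul_ghost, mul_assoc, this, ← monomial_nil]
      exact monomial_mem _ (by simp) (by simp at hk ⊢; omega)
    · rw [ghost_mul_vertex_of_ne h, zero_mul]
      exact zero_mem _
  | f :: α, hn, hk =>
    rw [monomial_cons, ← mul_assoc]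
    by_cases h : e = f
    · rw [h, ghost_mul_edge_self]
      exact vertex_mul_mem _ (monomial_mem v (by simp at hn; omega) (by simp at hk; omega))
    · rw [ghost_mul_edge_of_ne h, zero_mul]
      exact zero_mem _

theorem edgeProd_mul_mem (α : List E.Edge) {n k : ℤ} {x : E.LeavittPathAlgebra ℓ}
    (hx : x ∈ filtration ℓ E n k) :
    edgeProd ℓ E α * x ∈ filtration ℓ E (n + α.length) (k + α.length) := by
  induction α with
  | nil => simpa [edgeProd] using hx
  | cons e α ih =>
    have := edge_mul_mem e ih
    simpa [edgeProd, mul_assoc, add_assoc] using this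

theorem ghostProd_mul_mem (β : List E.Edge) {n k : ℤ} {x : E.LeavittPathAlgebra ℓ}
    (hn : 0 ≤ n) (hx : x ∈ filtration ℓ E n k) :
    ghostProd ℓ E β * x ∈ filtration ℓ E (max (n - β.length) 0) (k - β.length) := by
  induction β with
  | nil => simpa [ghostProd, hn] using hx
  | cons e β ih =>
    have := ghost_mul_mem e ih
    have h : ghostProd ℓ E (e :: β) * x = gen ℓ E (.ghost e) * (ghostProd ℓ E β * x) := by
      simp [ghostProd, mul_assoc]
    rw [h]
    have h2 : k - ((e :: β).length : ℤ) = k - β.length - 1 := by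
      rw [List.length_cons]; push_cast; ring
    rw [h2]
    refine filtration_mono _ ?_ this
    rw [List.length_cons]; push_cast; omega

/-- The ghost word `β` of a monomial in `x` first removes `|β|` edges from `y`, as far as there are
any, and then `|α|` edges are added. Since `|α| - |β| = j`, the outcome has at most `max |α| (n +
j)` edges. The bound is a maximum and not a sum: in degree `j = 0` the pieces of the filtration with
`n ≥ 0` are therefore closed under multiplication. -/
theorem mul_mem_filtration {m n j k : ℤ} {x y : E.LeavittPathAlgebra ℓ} (hn : 0 ≤ n)
    (hx : x ∈ filtration ℓ E m j) (hy : y ∈ filtration ℓ E n k) :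
    x * y ∈ filtration ℓ E (max m (n + j)) (j + k) := by
  unfold filtration at hx
  induction hx using Submodule.span_induction with
  | mem x hx =>
    obtain ⟨α, v, β, hm, hj, rfl⟩ := hx
    rw [monomial, mul_assoc, mul_assoc]
    have := edgeProd_mul_mem α (vertex_mul_mem v (ghostProd_mul_mem β hn hy))
    rw [show j + k = k - β.length + α.length by omega]
    exact filtration_mono _ (by omega) this
  | zero => rw [zero_mul]; exact zero_mem _
  | add x z _ _ hx hz => rw [add_mul]; exact add_mem hx hz
  | smul c x _ hx => rw [smul_mul_assoc]; exact Submodule.smul_mem _ c hx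

theorem one_mem_filtration : (1 : E.LeavittPathAlgebra ℓ) ∈ filtration ℓ E 0 0 := by
  rw [← sum_vertex]
  refine sum_mem fun v _ => ?_
  have : gen ℓ E (.vertex v) = monomial ℓ E [] v [] := by simp [monomial_nil, ghostProd]
  rw [this]
  exact monomial_mem v (by simp) (by simp)

/-- Any word in the generators is reduced to normal form by multiplying `1` on the left by one
generator at a time, with the number of edges under control at each stage. -/
theorem exists_mem_filtration {k : ℤ} {x : E.LeavittPathAlgebra ℓ} (hx : x ∈ gr ℓ E k) :
    ∃ n, 0 ≤ n ∧ x ∈ filtration ℓ E n k := by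
  unfold gr at hx
  induction hx using Submodule.span_induction with
  | mem x hx =>
    obtain ⟨w, rfl, rfl⟩ := hx
    induction w with
    | nil => exact ⟨0, le_rfl, by simpa using one_mem_filtration⟩
    | cons g w ih =>
      obtain ⟨n, hn, h⟩ := ih
      simp only [List.map_cons, List.prod_cons, List.sum_cons]
      cases g with
      | vertex v => exact ⟨n, hn, by simpa [LeavittGen.degree] using vertex_mul_mem v h⟩
      | edge e => exact ⟨n + 1, by omega, by
          simpa [LeavittGen.degree, add_comm] using edge_mul_mem e h⟩
      | ghost e => exact ⟨max (n - 1) 0, by omega, by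
          simpa only [LeavittGen.degree, neg_add_eq_sub] using ghost_mul_mem e h⟩
  | zero => exact ⟨0, le_rfl, zero_mem _⟩
  | add x y _ _ hx hy =>
    obtain ⟨n, hn, h⟩ := hx
    obtain ⟨m, hm, h'⟩ := hy
    exact ⟨max n m, by omega, add_mem (filtration_mono _ (le_max_left _ _) h)
      (filtration_mono _ (le_max_right _ _) h')⟩
  | smul c x _ hx =>
    obtain ⟨n, hn, h⟩ := hx
    exact ⟨n, hn, Submodule.smul_mem _ c h⟩

theorem sum_vertex_mul (x : E.LeavittPathAlgebra ℓ) :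
    ∑ v : E.Vertex, gen ℓ E (.vertex v) * x = x := by
  rw [← Finset.sum_mul, sum_vertex, one_mul]

end Monomials

/-! ### Graded ideals and the graded uniqueness theorem. -/

section Uniqueness

variable {ℓ : Type*} [Field ℓ] {E : DirectedGraph} [Fintype E.Vertex] [Fintype E.Edge]
  {I : Submodule ℓ (E.LeavittPathAlgebra ℓ)}

variable (ℓ E) in
/-- The span of the products of a vertex and `m` ghost edges. -/
noncomputable def ghostSpan (m : ℕ) : Submodule ℓ (E.LeavittPathAlgebra ℓ) :=
  Submodule.span ℓ {x | ∃ v β, β.length = m ∧ gen ℓ E (.vertex v) * ghostProd ℓ E β = x}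

theorem ghostProd_concat (β : List E.Edge) (e : E.Edge) :
    ghostProd ℓ E (β ++ [e]) = ghostProd ℓ E β * gen ℓ E (.ghost e) := by
  simp [ghostProd]

theorem ghostSpan_mul_vertex (w : E.Vertex) {m : ℕ} {x : E.LeavittPathAlgebra ℓ}
    (hx : x ∈ ghostSpan ℓ E m) : x * gen ℓ E (.vertex w) ∈ ghostSpan ℓ E m := by
  have : ghostSpan ℓ E m ≤
      (ghostSpan ℓ E m).comap (LinearMap.mulRight ℓ (gen ℓ E (.vertex w))) := by
    conv_lhs => rw [ghostSpan]
    rw [Submodule.span_le]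
    rintro _ ⟨v, β, hβ, rfl⟩
    change gen ℓ E (.vertex v) * ghostProd ℓ E β * gen ℓ E (.vertex w) ∈ ghostSpan ℓ E m
    rcases List.eq_nil_or_concat' β with rfl | ⟨β, e, rfl⟩
    · by_cases h : v = w
      · rw [← h]
        exact Submodule.subset_span ⟨v, [], hβ, by simp [ghostProd, vertex_mul_self]⟩
      · simp [ghostProd, vertex_mul_of_ne h]
    · by_cases h : E.source e = w
      · rw [ghostProd_concat, ← h, mul_assoc, mul_assoc, ghost_mul_source, ← ghostProd_concat]
        exact Submodule.subset_span ⟨v, _, hβ, rfl⟩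
      · rw [ghostProd_concat, mul_assoc, mul_assoc, ghost_mul_vertex_of_ne h, mul_zero, mul_zero]
        exact zero_mem _
  exact this hx

theorem ghostSpan_mul_edge (e : E.Edge) {m : ℕ} {x : E.LeavittPathAlgebra ℓ}
    (hx : x ∈ ghostSpan ℓ E (m + 1)) : x * gen ℓ E (.edge e) ∈ ghostSpan ℓ E m := by
  have : ghostSpan ℓ E (m + 1) ≤
      (ghostSpan ℓ E m).comap (LinearMap.mulRight ℓ (gen ℓ E (.edge e))) := by
    conv_lhs => rw [ghostSpan]
    rw [Submodule.span_le]
    rintro _ ⟨v, β, hβ, rfl⟩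
    change gen ℓ E (.vertex v) * ghostProd ℓ E β * gen ℓ E (.edge e) ∈ ghostSpan ℓ E m
    rcases List.eq_nil_or_concat' β with rfl | ⟨β, f, rfl⟩
    · simp at hβ
    · rw [ghostProd_concat, mul_assoc, mul_assoc]
      by_cases h : f = e
      · rw [h, ghost_mul_edge_self, ← mul_assoc]
        exact ghostSpan_mul_vertex _ (Submodule.subset_span ⟨v, β, by simpa using hβ, rfl⟩)
      · rw [ghost_mul_edge_of_ne h, mul_zero, mul_zero]
        exact zero_mem _
  exact this hx

/-- If a ghost word ends in `f*`, only the summand `e = f` survives, and `f* f f* = f*`.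
Consequently a non-zero `x` of this kind is not annihilated by all edges on the right. -/
theorem ghostSpan_sum_mul_edge_mul_ghost {m : ℕ} {x : E.LeavittPathAlgebra ℓ}
    (hx : x ∈ ghostSpan ℓ E (m + 1)) :
    ∑ e : E.Edge, x * gen ℓ E (.edge e) * gen ℓ E (.ghost e) = x := by
  unfold ghostSpan at hx
  induction hx using Submodule.span_induction with
  | mem x hx =>
    obtain ⟨v, β, hβ, rfl⟩ := hx
    rcases List.eq_nil_or_concat' β with rfl | ⟨β, f, rfl⟩
    · simp at hβ
    · rw [Finset.sum_eq_single f]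
      · rw [ghostProd_concat]
        simp only [mul_assoc]
        rw [← mul_assoc (gen ℓ E (.ghost f)), ghost_mul_edge_self, range_mul_ghost]
      · intro e _ h
        rw [ghostProd_concat]
        simp only [mul_assoc]
        rw [← mul_assoc (gen ℓ E (.ghost f)), ghost_mul_edge_of_ne h.symm]
        simp
      · simp
  | zero => simp
  | add x y _ _ hx hy => simp only [add_mul, Finset.sum_add_distrib, hx, hy]
  | smul c x _ hx => simp only [smul_mul_assoc, ← Finset.smul_sum, hx]

/-- A subspace closed under multiplication that contains a non-zero combination of ghost paths
contains a non-zero vertex. -/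
theorem exists_vertex_of_ghostSpan (hl : ∀ a, ∀ x ∈ I, a * x ∈ I) (hr : ∀ a, ∀ x ∈ I, x * a ∈ I)
    {m : ℕ} {x : E.LeavittPathAlgebra ℓ} (hx : x ∈ ghostSpan ℓ E m) (hI : x ∈ I) (h0 : x ≠ 0) :
    ∃ v, gen ℓ E (.vertex v) ∈ I ∧ gen ℓ E (.vertex v) ≠ 0 := by
  induction m generalizing x with
  | zero =>
    -- With no ghost edges left, `x` is a combination of orthogonal vertices, and multiplication by
    -- `w` picks out one of them. Non-vanishing of the vertex found is inherited from `x`, so linear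
    -- independence of the vertices is not needed.
    have key : ∀ w, ∃ c : ℓ, gen ℓ E (.vertex w) * x = c • gen ℓ E (.vertex w) := by
      intro w
      have : ghostSpan ℓ E 0 ≤ (ℓ ∙ gen ℓ E (.vertex w)).comap
          (LinearMap.mulLeft ℓ (gen ℓ E (.vertex w))) := by
        rw [ghostSpan, Submodule.span_le]
        rintro _ ⟨v, β, hβ, rfl⟩
        rw [List.length_eq_zero_iff] at hβ
        subst hβ
        change gen ℓ E (.vertex w) * (gen ℓ E (.vertex v) * ghostProd ℓ E []) ∈
          (ℓ ∙ gen ℓ E (.vertex w) : Submodule ℓ (E.LeavittPathAlgebra ℓ))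
        by_cases h : w = v
        · rw [← h]
          simp [ghostProd, vertex_mul_self, Submodule.mem_span_singleton_self]
        · simp [ghostProd, vertex_mul_of_ne h]
      obtain ⟨c, hc⟩ := Submodule.mem_span_singleton.1 (this hx)
      exact ⟨c, hc.symm⟩
    have : ∃ w, gen ℓ E (.vertex w) * x ≠ 0 := by
      by_contra! h
      exact h0 (by rw [← sum_vertex_mul x]; simp [h])
    obtain ⟨w, hw⟩ := this
    obtain ⟨c, hc⟩ := key w
    have hc0 : c ≠ 0 := by rintro rfl; simp [hc] at hw
    refine ⟨w, ?_, fun h => hw (by rw [h, zero_mul])⟩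
    have := I.smul_mem c⁻¹ (hl (gen ℓ E (.vertex w)) x hI)
    rwa [hc, smul_smul, inv_mul_cancel₀ hc0, one_smul] at this
  | succ m ih =>
    have : ∃ e, x * gen ℓ E (.edge e) ≠ 0 := by
      by_contra! h
      exact h0 (by rw [← ghostSpan_sum_mul_edge_mul_ghost hx]; simp [h])
    obtain ⟨e, he⟩ := this
    exact ih (ghostSpan_mul_edge e hx) (hr _ _ hI) he

/-- Without edges, the degree determines the length of the ghost word. For `k > 0` the left side is
zero, so the value of `toNat` there is immaterial. -/
theorem filtration_zero_le (k : ℤ) : filtration ℓ E 0 k ≤ ghostSpan ℓ E (-k).toNat := by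
  rw [filtration, Submodule.span_le]
  rintro _ ⟨α, v, β, hn, hk, rfl⟩
  have : α = [] := List.length_eq_zero_iff.1 (by omega)
  subst this
  rw [monomial_nil]
  exact Submodule.subset_span ⟨v, β, by simp at hk; omega, rfl⟩

/-- No edge starts at a sink, so every monomial that begins with an edge is killed on the left by
it. -/
theorem sink_mul_mem {v : E.Vertex} (hv : ¬ ∃ e, E.source e = v) {n k : ℤ}
    {x : E.LeavittPathAlgebra ℓ} (hx : x ∈ filtration ℓ E n k) :
    gen ℓ E (.vertex v) * x ∈ filtration ℓ E 0 k := by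
  refine mul_mem_of_monomial hx fun α w β hn hk => ?_
  match α, hn, hk with
  | [], hn, hk => exact vertex_mul_mem v (monomial_mem w (by simp) hk)
  | e :: α, hn, hk =>
    rw [monomial_cons, ← mul_assoc, vertex_mul_edge_of_ne fun h => hv ⟨e, h.symm⟩, zero_mul]
    exact zero_mem _

theorem exists_vertex_of_filtration (hl : ∀ a, ∀ x ∈ I, a * x ∈ I)
    (hr : ∀ a, ∀ x ∈ I, x * a ∈ I) (n : ℕ) {k : ℤ} {x : E.LeavittPathAlgebra ℓ}
    (hx : x ∈ filtration ℓ E n k) (hI : x ∈ I) (h0 : x ≠ 0) :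
    ∃ v, gen ℓ E (.vertex v) ∈ I ∧ gen ℓ E (.vertex v) ≠ 0 := by
  induction n generalizing k x with
  | zero => exact exists_vertex_of_ghostSpan hl hr (filtration_zero_le k hx) hI h0
  | succ n ih =>
    -- Either some ghost edge lowers the number of edges without killing `x`, or all of them kill
    -- `x`. In the second case `v x = ∑ e e* x = 0` for every regular `v`, so `x` survives only at
    -- sinks, where no edges are left.
    by_cases h : ∃ e, gen ℓ E (.ghost e) * x ≠ 0
    · obtain ⟨e, he⟩ := h
      exact ih (filtration_mono _ (by push_cast; omega) (ghost_mul_mem e hx)) (hl _ _ hI) he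
    push Not at h
    have : ∃ v, gen ℓ E (.vertex v) * x ≠ 0 := by
      by_contra! h
      exact h0 (by rw [← sum_vertex_mul x]; simp [h])
    obtain ⟨v, hv⟩ := this
    have hs : ¬ ∃ e, E.source e = v := by
      intro hs
      apply hv
      rw [← sum_edge_mul_ghost hs, Finset.sum_mul]
      exact Finset.sum_eq_zero fun e _ => by rw [mul_assoc, h e, mul_zero]
    exact exists_vertex_of_ghostSpan hl hr (filtration_zero_le k (sink_mul_mem hs hx))
      (hl _ _ hI) hv

/-- The graded uniqueness theorem: a graded homomorphism that is not injective kills a non-zero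
vertex. -/
theorem exists_vertex_of_not_injective {R : Type*} [NonUnitalRing R] [Module ℓ R]
    (ℛ : ℤ → Submodule ℓ R) [DirectSum.Decomposition ℛ] (f : E.LeavittPathAlgebra ℓ →ₙₐ[ℓ] R)
    (hf : ∀ n, ∀ a ∈ gr ℓ E n, f a ∈ ℛ n) (h : ¬ Function.Injective f) :
    ∃ v, f (gen ℓ E (.vertex v)) = 0 ∧ gen ℓ E (.vertex v) ≠ 0 := by
  classical
  obtain ⟨x, hx, hx0⟩ : ∃ x, f x = 0 ∧ x ≠ 0 := by
    by_contra! H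
    exact h ((injective_iff_map_eq_zero f).2 H)
  -- A degree-preserving map commutes with taking homogeneous components, so its kernel contains the
  -- components of each of its elements.
  have hcomp : ∀ y n, f (DirectSum.decompose (gr ℓ E) y n) = DirectSum.decompose ℛ (f y) n := by
    intro y n
    induction y using DirectSum.Decomposition.inductionOn (gr ℓ E) with
    | zero => simp
    | @homogeneous i a =>
      by_cases hin : i = n
      · subst hin
        rw [DirectSum.decompose_of_mem_same _ a.2, DirectSum.decompose_of_mem_same _ (hf _ _ a.2)]
      · rw [DirectSum.decompose_of_mem_ne _ a.2 hin,
          DirectSum.decompose_of_mem_ne _ (hf _ _ a.2) hin, map_zero]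
    | add a b ha hb =>
      simp only [map_add, DirectSum.decompose_add, DirectSum.add_apply, Submodule.coe_add, ha, hb]
  obtain ⟨n, hn⟩ : ∃ n, (DirectSum.decompose (gr ℓ E) x n : E.LeavittPathAlgebra ℓ) ≠ 0 := by
    by_contra! H
    apply hx0
    rw [← DirectSum.sum_support_decompose (gr ℓ E) x]
    exact Finset.sum_eq_zero fun i _ => H i
  obtain ⟨m, hm, hmem⟩ := exists_mem_filtration (DirectSum.decompose (gr ℓ E) x n).2
  lift m to ℕ using hm
  refine exists_vertex_of_filtration (I := LinearMap.ker (f : E.LeavittPathAlgebra ℓ →ₗ[ℓ] R))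
    (fun a y hy => ?_) (fun a y hy => ?_) m hmem ?_ hn
  · have hy' : f y = 0 := hy
    change f (a * y) = 0
    rw [map_mul, hy', mul_zero]
  · have hy' : f y = 0 := hy
    change f (y * a) = 0
    rw [map_mul, hy', zero_mul]
  · change f _ = 0
    rw [hcomp, hx]
    simp

end Uniqueness

end DirectedGraph.LeavittPathAlgebra

namespace GradedK

universe u v w

/-! ### Modules generated by idempotents, and classes that vanish in `K0`. -/

section Idempotent

open MulOpposite

variable {A : Type u} [Ring A]

/-- Left multiplication as an endomorphism of the right regular module. -/
def leftMul (p : A) : A →ₗ[Aᵐᵒᵖ] A where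
  toFun x := p * x
  map_add' := mul_add p
  map_smul' a x := by
    rw [← op_unop a, op_smul_eq_mul, RingHom.id_apply, op_smul_eq_mul, mul_assoc]

theorem leftMul_mem_range {p : A} (hp : IsIdempotentElem p) (m : LinearMap.range (leftMul p)) :
    p * (m : A) = m := by
  obtain ⟨_, x, rfl⟩ := m
  change p * (p * x) = p * x
  rw [← mul_assoc, hp.eq]

variable (A) in
/-- The right regular module is free of rank one. -/
def regularEquiv : A ≃ₗ[Aᵐᵒᵖ] Aᵐᵒᵖ :=
  { opAddEquiv with map_smul' := fun _ _ => rfl }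

instance finite_range_leftMul (p : A) : Module.Finite Aᵐᵒᵖ (LinearMap.range (leftMul p)) :=
  have : Module.Finite Aᵐᵒᵖ A := .equiv (regularEquiv A).symm
  .of_surjective (leftMul p).rangeRestrict (leftMul p).surjective_rangeRestrict

theorem projective_range_leftMul {p : A} (hp : IsIdempotentElem p) :
    Module.Projective Aᵐᵒᵖ (LinearMap.range (leftMul p)) :=
  have : Module.Projective Aᵐᵒᵖ A := .of_equiv (regularEquiv A).symm
  .of_split (LinearMap.range (leftMul p)).subtype (leftMul p).rangeRestrict
    (LinearMap.ext fun m => Subtype.ext (leftMul_mem_range hp m))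

variable (p : A) in
/-- The inclusion into the ring of the right ideal generated by an element, in a larger
universe. -/
def rangeIncl : ULift.{w} (LinearMap.range (leftMul p)) →+ A :=
  AddMonoidHom.mk' (fun m => (m.down : A)) fun _ _ => rfl

/-- The graded right ideal generated by an idempotent of degree zero. -/
def GrProj.ofIdempotent (𝒜 : ℤ → AddSubgroup A) [GradedRing 𝒜] {p : A}
    (hp : IsIdempotentElem p) (h0 : p ∈ 𝒜 0) : GrProj.{u, max u w} 𝒜 where
  carrier := ULift.{w} (LinearMap.range (leftMul p))
  gr i := (𝒜 i).comap (rangeIncl p)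
  isInternal := by
    -- The retraction `x ↦ p x` of the ring onto the right ideal. It preserves degrees because `p`
    -- has degree zero, so the grading of the ring induces one on the ideal.
    let r : A →+ ULift.{w} (LinearMap.range (leftMul p)) :=
      AddEquiv.ulift.symm.toAddMonoidHom.comp (leftMul p).rangeRestrict.toAddMonoidHom
    have hr : ∀ m : ULift.{w} (LinearMap.range (leftMul p)), r (m.down : A) = m := fun m =>
      ULift.ext _ _ (Subtype.ext (leftMul_mem_range hp m.down))
    have hA := DirectSum.Decomposition.isInternal 𝒜
    refine isInternal_of_split (((Finsupp.mapRange.addMonoidHom r).comp (split hA)).comp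
      (rangeIncl p)) (fun i m hm => ?_) fun m => ?_
    · change Finsupp.mapRange.addMonoidHom r (split hA (rangeIncl p m)) = _
      rw [split_of_mem hA (AddSubgroup.mem_comap.1 hm), Finsupp.mapRange.addMonoidHom_apply,
        Finsupp.mapRange_single]
      exact congrArg _ (hr m)
    · rw [← hr m]
      induction (m.down : A) using hom_induction hA with
      | hom i x hx =>
        refine AddSubgroup.mem_iSup_of_mem i ?_
        change p * x ∈ 𝒜 i
        simpa using SetLike.mul_mem_graded h0 hx
      | add x y hx hy => rw [map_add]; exact add_mem hx hy
  smul_mem {i j m a} hm ha := by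
    change (m.down : A) * a ∈ 𝒜 (i + j)
    exact SetLike.mul_mem_graded (AddSubgroup.mem_comap.1 hm) ha
  finite := .equiv ULift.moduleEquiv.symm
  projective :=
    have := projective_range_leftMul hp
    .of_equiv ULift.moduleEquiv.symm

theorem GrProj.iso_zero {𝒜 : ℤ → AddSubgroup A} (M : GrProj.{u, v} 𝒜)
    (h : ∀ x : M.carrier, x = 0) : Iso M (zero.{u, w} 𝒜) :=
  BaseChange.exists_equiv (X := M.carrier) (Y := PUnit) 0 0 (fun _ _ => rfl)
    (fun x => (h x).symm) (fun _ => rfl) (fun _ _ _ => trivial) (fun _ _ _ => zero_mem _)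

/-- The module has a generator `g` with `g p = g`, so every pure tensor can be written with a factor
`φ p = 0` moved across the tensor sign. -/
theorem GrProj.baseChange_ofIdempotent_iso_zero {𝒜 : ℤ → AddSubgroup A} [GradedRing 𝒜]
    {B : Type v} [Ring B] {ℬ : ℤ → AddSubgroup B} [GradedRing ℬ] {p : A}
    (hp : IsIdempotentElem p) (h0 : p ∈ 𝒜 0) (φ : 𝒜 →+*ᵍ ℬ) (hφ : φ p = 0) :
    Iso ((ofIdempotent.{u, w} 𝒜 hp h0).baseChange φ) (zero ℬ) := by
  refine iso_zero _ fun x => ?_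
  induction x using BaseChange.induction with
  | add x y hx hy => subst hx hy; exact _root_.add_zero _
  | tmul m b =>
    let g : (ofIdempotent.{u, w} 𝒜 hp h0).carrier := ULift.up ((leftMul p).rangeRestrict p)
    have h1 : m = op (m.down : A) • g := ULift.ext _ _ (Subtype.ext (by
      change (m.down : A) = p * p * m.down
      rw [hp.eq, leftMul_mem_range hp]))
    have h2 : g = op p • g := ULift.ext _ _ (Subtype.ext (by
      change p * p = p * p * p
      rw [hp.eq, hp.eq]))
    have hφ' : φ.toRingHom p = 0 := hφ
    rw [h1, ← BaseChange.tmul_mul, h2, ← BaseChange.tmul_mul, hφ', zero_mul,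
      BaseChange.tmul_zero]
    rfl

theorem K0.of_eq_zero_of_iso {𝒜 : ℤ → AddSubgroup A} {M : GrProj.{u, w} 𝒜}
    (h : GrProj.Iso M (GrProj.zero.{u, w} 𝒜)) : K0.of M = 0 := by
  have : IsoClass.mk M = 0 := Quotient.sound h
  rw [K0.of, this, map_zero]

/-- A module whose class vanishes in `K₀` is stably zero. -/
theorem K0.exists_iso_of_eq_zero {𝒜 : ℤ → AddSubgroup A} {M : GrProj.{u, w} 𝒜}
    (h : K0.of M = 0) : ∃ P : GrProj.{u, w} 𝒜, GrProj.Iso (M.prod P) P := by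
  -- Both sides are written as formal differences; two of these agree exactly when they become equal
  -- after adding a common class, which supplies `P`.
  have h' : AddLocalization.mk (IsoClass.mk M) (0 : (⊤ : AddSubmonoid (IsoClass.{u, w} 𝒜))) =
      AddLocalization.mk 0 0 := by
    rw [AddLocalization.mk_zero]
    exact h
  rw [AddLocalization.mk_eq_mk_iff, AddLocalization.r_iff_exists] at h'
  obtain ⟨⟨⟨P⟩, _⟩, hP⟩ := h'
  simp only [AddSubmonoid.coe_zero, _root_.zero_add] at hP
  refine ⟨P, Quotient.exact (s := GrProj.isoSetoid 𝒜) ?_⟩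
  change IsoClass.mk M + IsoClass.mk P = IsoClass.mk P
  rw [_root_.add_comm]
  exact hP.trans (_root_.add_zero _)

end Idempotent

/-! ### Idempotents killed by a homomorphism. -/

section NonUnital

variable {A : Type u} [NonUnitalRing A] {σ : Type*} [SetLike σ A] [AddSubgroupClass σ A]
  {𝒜 : ℤ → σ} {B : Type v} [NonUnitalRing B] {τ : Type*} [SetLike τ B] [AddSubgroupClass τ B]
  {ℬ : ℤ → τ} [SetLike.GradedMul 𝒜] [DirectSum.Decomposition 𝒜]
  [SetLike.GradedMul ℬ] [DirectSum.Decomposition ℬ]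

/-- If an injective map between graded `K₀`-groups is induced by a homomorphism that kills an
idempotent, then the class of this idempotent vanishes. -/
theorem K0gr.of_ofIdempotent_eq_zero {p : A} (hp : IsIdempotentElem (ZUnit.inr p))
    (h0 : ZUnit.inr p ∈ unitGr 𝒜 0) {f : A →ₙ+* B} (hf : ∀ n, ∀ a ∈ 𝒜 n, f a ∈ ℬ n)
    (hfp : f p = 0) (hK : Function.Injective (K0gr.map.{u, v} f hf)) :
    K0.of (GrProj.ofIdempotent.{u, max u v} (unitGr 𝒜) hp h0) = 0 := by
  let M := GrProj.ofIdempotent.{u, max u v} (unitGr 𝒜) hp h0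
  -- The projection of the unitalization to `ℤ` kills `p`, so the module dies over `ℤ`.
  have hM : K0.of M ∈ K0gr.{u, v} 𝒜 := by
    rw [K0gr, AddMonoidHom.mem_ker]
    exact (K0.map_of _ M).trans (K0.of_eq_zero_of_iso
      (GrProj.baseChange_ofIdempotent_iso_zero hp h0 _ (ZUnit.fst_inr p)))
  refine congrArg Subtype.val (hK (a₁ := ⟨K0.of M, hM⟩) (a₂ := 0) (Subtype.ext ?_))
  rw [map_zero]
  exact (K0.map_of _ M).trans (K0.of_eq_zero_of_iso
    (GrProj.baseChange_ofIdempotent_iso_zero hp h0 _ (ZUnit.ext rfl hfp)))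

end NonUnital

/-! ### Homogeneous generators and coefficients of graded modules. -/

section Generators

open MulOpposite

variable {A : Type u} [Ring A] {𝒜 : ℤ → AddSubgroup A}

theorem GrProj.exists_homogeneous_generators (M : GrProj.{u, w} 𝒜) :
    ∃ (T : Finset M.carrier) (d : T → ℤ), (∀ j : T, (j : M.carrier) ∈ M.gr (d j)) ∧
      Submodule.span Aᵐᵒᵖ (T : Set M.carrier) = ⊤ := by
  have h : Submodule.span Aᵐᵒᵖ {m | ∃ i, m ∈ M.gr i} = ⊤ := by
    rw [eq_top_iff]
    rintro m -
    induction m using hom_induction M.isInternal with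
    | hom i m hm => exact Submodule.subset_span ⟨i, hm⟩
    | add x y hx hy => exact add_mem hx hy
  have hfg : (Submodule.span Aᵐᵒᵖ {m | ∃ i, m ∈ M.gr i}).FG := h ▸ Module.Finite.fg_top
  obtain ⟨T, hT, hspan⟩ := Submodule.fg_span_iff_fg_span_finset_subset _ |>.1 hfg
  choose d hd using fun j : T => hT j.2
  exact ⟨T, d, hd, by rw [← hspan, h]⟩

variable [GradedRing 𝒜]

/-- This is what allows the coefficients in an expression for a homogeneous element to be replaced
by their components of the correct degree. -/
theorem GrProj.split_op_smul (M : GrProj.{u, w} 𝒜) {d : ℤ} {p : M.carrier} (hp : p ∈ M.gr d)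
    (a : A) (k : ℤ) :
    split M.isInternal (op a • p) k = op (DirectSum.decompose 𝒜 a (k - d) : A) • p := by
  classical
  induction a using DirectSum.Decomposition.inductionOn 𝒜 with
  | zero => simp
  | @homogeneous i a =>
    rw [split_of_mem M.isInternal (M.smul_mem hp a.2)]
    by_cases h : d + i = k
    · obtain rfl : i = k - d := by omega
      rw [DirectSum.decompose_of_mem_same _ a.2, h, Finsupp.single_eq_same]
    · rw [DirectSum.decompose_of_mem_ne _ a.2 (by omega), Finsupp.single_eq_of_ne (Ne.symm h),
        op_zero, zero_smul]
  | add a b ha hb =>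
    rw [op_add, add_smul, map_add, Finsupp.add_apply, ha, hb, DirectSum.decompose_add,
      DirectSum.add_apply, AddSubgroup.coe_add, op_add, add_smul]

/-- A homogeneous element is a combination of homogeneous generators with homogeneous
coefficients. -/
theorem GrProj.exists_homogeneous_coeffs (M : GrProj.{u, w} 𝒜) {T : Finset M.carrier}
    {d : T → ℤ} (hd : ∀ j : T, (j : M.carrier) ∈ M.gr (d j))
    (hT : Submodule.span Aᵐᵒᵖ (T : Set M.carrier) = ⊤) {k : ℤ} {y : M.carrier}
    (hy : y ∈ M.gr k) :
    ∃ a : T → A, (∀ j, a j ∈ 𝒜 (k - d j)) ∧ y = ∑ j, op (a j) • (j : M.carrier) := by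
  have hy' : y ∈ Submodule.span Aᵐᵒᵖ (Set.range fun j : T => (j : M.carrier)) := by
    have : Set.range (fun j : T => (j : M.carrier)) = (T : Set M.carrier) := by
      ext; simp
    rw [this, hT]
    trivial
  obtain ⟨c, hc⟩ := (Submodule.mem_span_range_iff_exists_fun _).1 hy'
  refine ⟨fun j => DirectSum.decompose 𝒜 (unop (c j)) (k - d j), fun j => SetLike.coe_mem _, ?_⟩
  calc y = split M.isInternal y k := by rw [split_of_mem _ hy, Finsupp.single_eq_same]
    _ = ∑ j : T, split M.isInternal (op (unop (c j)) • (j : M.carrier)) k := by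
      rw [← hc, map_sum, Finsupp.finsetSum_apply]
      rfl
    _ = _ := Finset.sum_congr rfl fun j _ => M.split_op_smul (hd j) _ _

end Generators

/-! ### The unitalization of a ring that already has a unit. -/

section Unital

variable {A : Type u} [Ring A]

/-- The ring `A` is an ideal of its unitalization, on which `(k, a)` acts through its image `k · 1 +
a` under the projection onto `A`. Thus coefficients in the unitalization become coefficients in `A`
after multiplication by an element of `A`. -/
theorem ZUnit.mul_inr (b : ZUnit A) (z : A) :
    b * ZUnit.inr z = ZUnit.inr ((b.fst • (1 : A) + b.snd) * z) :=
  ZUnit.ext (by simp) (by simp [ZUnit.snd_mul, add_mul])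

theorem ZUnit.inr_mul_inr (a b : A) : ZUnit.inr a * ZUnit.inr b = ZUnit.inr (a * b) :=
  ZUnit.ext (by simp) (by simp [ZUnit.snd_mul])

theorem zsmul_one_add_snd_mem {σ : Type*} [SetLike σ A] [AddSubgroupClass σ A] (𝒜 : ℤ → σ)
    [SetLike.GradedMonoid 𝒜] {n : ℤ} {b : ZUnit A} (hb : b ∈ unitGr 𝒜 n) :
    b.fst • (1 : A) + b.snd ∈ 𝒜 n := by
  refine add_mem ?_ hb.2
  by_cases hn : n = 0
  · subst hn
    exact zsmul_mem (SetLike.GradedOne.one_mem) _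
  · rw [(mem_intGr_of_ne hn).1 hb.1, zero_smul]
    exact zero_mem _

end Unital

/-! ### A finite-dimensional injectivity argument. -/

section LinearAlgebra

/-- An endomorphism that is injective modulo `K` is surjective modulo `K` on a finite-dimensional
invariant subspace. -/
theorem exists_sub_mem_of_invariant {k V : Type*} [Field k] [AddCommGroup V] [Module k V]
    (X : V →ₗ[k] V) (F K : Submodule k V) [Module.Finite k F] (hF : ∀ z ∈ F, X z ∈ F)
    (hK : ∀ z, X z ∈ K ↔ z ∈ K) {z : V} (hz : z ∈ F) : ∃ z' ∈ F, z - X z' ∈ K := by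
  -- The equivalence in `hK` says both that `X` descends to the quotient and that the induced map is
  -- injective there. The image of `F` in the quotient is finite-dimensional and invariant, so a
  -- dimension count shows that it is mapped onto itself.
  let Y : V ⧸ K →ₗ[k] V ⧸ K := K.mapQ K X fun z hz => (hK z).2 hz
  have hY : Function.Injective Y := by
    rw [injective_iff_map_eq_zero]
    intro q
    obtain ⟨z, rfl⟩ := K.mkQ_surjective q
    intro h
    have h' : K.mkQ (X z) = 0 := h
    rw [Submodule.mkQ_apply, Submodule.Quotient.mk_eq_zero] at h' ⊢
    exact (hK z).1 h'
  have hle : (F.map K.mkQ).map Y ≤ F.map K.mkQ := by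
    rintro _ ⟨_, ⟨z, hz, rfl⟩, rfl⟩
    exact ⟨X z, hF z hz, rfl⟩
  have heq : (F.map K.mkQ).map Y = F.map K.mkQ :=
    Submodule.eq_of_le_of_finrank_eq hle
      ((F.map K.mkQ).equivMapOfInjective Y hY).finrank_eq.symm
  have hz' : K.mkQ z ∈ (F.map K.mkQ).map Y := by
    rw [heq]
    exact Submodule.mem_map_of_mem hz
  obtain ⟨_, ⟨z', hz', rfl⟩, h⟩ := hz'
  refine ⟨z', hz', ?_⟩
  rw [← Submodule.Quotient.mk_eq_zero, Submodule.Quotient.mk_sub, sub_eq_zero]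
  exact h.symm

end LinearAlgebra

end GradedK

/-! ### Injective graded endomorphisms of finitely generated graded modules. -/

namespace DirectedGraph.LeavittPathAlgebra

open GradedK MulOpposite

variable {ℓ : Type*} [Field ℓ] {E : DirectedGraph} [Fintype E.Vertex] [Fintype E.Edge]

/-- Combinations of elements of a module over the unitalization, with coefficients in the Leavitt
path algebra. -/
noncomputable def combination {M : Type*} [AddCommGroup M]
    [Module (ZUnit (E.LeavittPathAlgebra ℓ))ᵐᵒᵖ M] {ι : Type*} [Fintype ι] (p : ι → M) :
    (ι → E.LeavittPathAlgebra ℓ) →+ M :=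
  AddMonoidHom.mk' (fun z => ∑ j, op (ZUnit.inr (z j)) • p j) fun z z' => by
    simp only [Pi.add_apply, map_add, op_add, add_smul, Finset.sum_add_distrib]

section Combination

variable {M : Type*} [AddCommGroup M] [Module (ZUnit (E.LeavittPathAlgebra ℓ))ᵐᵒᵖ M]
  {ι : Type*} [Fintype ι] (p : ι → M)

theorem combination_mul (z : ι → E.LeavittPathAlgebra ℓ) (c : E.LeavittPathAlgebra ℓ) :
    combination p (fun j => z j * c) = op (ZUnit.inr c) • combination p z := by
  change ∑ j, op (ZUnit.inr (z j * c)) • p j = _ • ∑ j, op (ZUnit.inr (z j)) • p j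
  rw [Finset.smul_sum]
  refine Finset.sum_congr rfl fun j _ => ?_
  rw [← mul_smul, ← op_mul, ZUnit.inr_mul_inr]

/-- The relations among the given elements with coefficients in the Leavitt path algebra. -/
noncomputable def relations : Submodule ℓ (ι → E.LeavittPathAlgebra ℓ) :=
  { (combination p).ker with
    smul_mem' := fun c z hz => by
      have hz' : combination p z = 0 := hz
      -- The module is not assumed to be a vector space over `ℓ`; but scalars are central in the
      -- Leavitt path algebra, so scaling a column amounts to acting by the right multiplication of
      -- the module.
      have h : c • z = fun j => z j * algebraMap ℓ (E.LeavittPathAlgebra ℓ) c := by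
        ext j
        rw [Pi.smul_apply, Algebra.smul_def, Algebra.commutes]
      change combination p (c • z) = 0
      rw [h, combination_mul, hz', smul_zero] }

theorem mem_relations {z : ι → E.LeavittPathAlgebra ℓ} :
    z ∈ relations p ↔ combination p z = 0 := Iff.rfl

theorem op_inr_smul_sum (b : ι → ZUnit (E.LeavittPathAlgebra ℓ)) (c : E.LeavittPathAlgebra ℓ) :
    op (ZUnit.inr c) • ∑ j, op (b j) • p j =
      combination p fun j =>
        ((b j).fst • (1 : E.LeavittPathAlgebra ℓ) + (b j).snd) * c := by
  rw [Finset.smul_sum]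
  refine Finset.sum_congr rfl fun j _ => ?_
  rw [← mul_smul, ← op_mul, ZUnit.mul_inr]

end Combination

/-- Left multiplication of columns by a matrix over the Leavitt path algebra. -/
noncomputable def columnMul {ι : Type*} [Fintype ι] (a : ι → ι → E.LeavittPathAlgebra ℓ) :
    (ι → E.LeavittPathAlgebra ℓ) →ₗ[ℓ] (ι → E.LeavittPathAlgebra ℓ) where
  toFun z i := ∑ j, a i j * z j
  map_add' z z' := by
    ext i
    simp only [Pi.add_apply, mul_add, Finset.sum_add_distrib]
  map_smul' c z := by
    ext i
    simp only [Pi.smul_apply, mul_smul_comm, Finset.smul_sum, RingHom.id_apply]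

/-- The degree-zero part of a matrix ring over the Leavitt path algebra is locally
finite-dimensional, so that an injective graded endomorphism of a finitely generated graded module
is surjective on its unital part. -/
theorem exists_eq_of_injective (P : GrProj (unitGr (gr ℓ E)))
    (x : P.carrier →ₗ[(ZUnit (E.LeavittPathAlgebra ℓ))ᵐᵒᵖ] P.carrier)
    (hinj : Function.Injective x) (hx : ∀ i, ∀ m ∈ P.gr i, x m ∈ P.gr i) {k : ℤ}
    {y : P.carrier} (hy : y ∈ P.gr k) :
    ∃ y', x y' = op (ZUnit.inr (1 : E.LeavittPathAlgebra ℓ)) • y := by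
  obtain ⟨T, d, hd, hT⟩ := P.exists_homogeneous_generators
  -- The endomorphism is lifted to a matrix on homogeneous generators: `b j i` is the coefficient of
  -- the `i`-th generator in the image of the `j`-th, homogeneous of degree `d j - d i`.
  choose b hb hxb using fun j : T => P.exists_homogeneous_coeffs hd hT (hx _ _ (hd j))
  obtain ⟨c, hc, rfl⟩ := P.exists_homogeneous_coeffs hd hT hy
  let p : T → P.carrier := Subtype.val
  -- Matrix and target vector are projected from the unitalization to the Leavitt path algebra. This
  -- is why only the unital part is reached: over `ℤ` itself an injective endomorphism, such as
  -- multiplication by `2`, need not be surjective.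
  let a : T → T → E.LeavittPathAlgebra ℓ := fun i j =>
    (b j i).fst • (1 : E.LeavittPathAlgebra ℓ) + (b j i).snd
  let z : T → E.LeavittPathAlgebra ℓ := fun j =>
    (c j).fst • (1 : E.LeavittPathAlgebra ℓ) + (c j).snd
  choose n _ ha using fun i j => exists_mem_filtration
    (zsmul_one_add_snd_mem (gr ℓ E) (hb j i) : a i j ∈ gr ℓ E (d j - d i))
  choose m hm hz using fun j => exists_mem_filtration
    (zsmul_one_add_snd_mem (gr ℓ E) (hc j) : z j ∈ gr ℓ E (k - d j))
  obtain ⟨N₁, hN₁⟩ := Finite.exists_le fun q : T × T => n q.1 q.2 + d q.1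
  obtain ⟨N₂, hN₂⟩ := Finite.exists_le fun j => m j + d j
  -- A common bound on the number of edges, shifted by the degrees of the generators, for all matrix
  -- entries and for the target column.
  let N := max N₁ N₂
  have hN₁' : ∀ i j, n i j ≤ N - d i := fun i j => by
    have := hN₁ (i, j)
    have := le_max_left N₁ N₂
    dsimp only [N] at *
    linarith
  have hN₂' : ∀ j, m j ≤ N - d j := fun j => by
    have := hN₂ j
    have := le_max_right N₁ N₂
    dsimp only [N] at *
    linarith
  -- Columns whose combination has degree `k`. The bound in row `j` is shifted by `d j`, exactly as
  -- the degree is, which makes the space invariant under the matrix.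
  let F : Submodule ℓ (T → E.LeavittPathAlgebra ℓ) :=
    Submodule.pi Set.univ fun j => filtration ℓ E (N - d j) (k - d j)
  have : Module.Finite ℓ F := Module.Finite.iff_fg.2
    (Submodule.fg_pi fun j => Module.Finite.iff_fg.1 (finite_filtration _ _))
  -- The matrix lifts the endomorphism to columns.
  have hcomm : ∀ z, combination p (columnMul a z) = x (combination p z) := by
    intro z
    have h1 : x (combination p z) = ∑ j, op (ZUnit.inr (z j)) • x (p j) := by
      change x (∑ j, op (ZUnit.inr (z j)) • p j) = _
      rw [map_sum]
      exact Finset.sum_congr rfl fun j _ => map_smul x _ _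
    have h2 : columnMul a z = ∑ j, fun i => a i j * z j := by
      ext i
      rw [Finset.sum_apply]
      rfl
    rw [h1, h2, map_sum]
    refine Finset.sum_congr rfl fun j _ => ?_
    rw [show x (p j) = ∑ i, op (b j i) • p i from hxb j, op_inr_smul_sum]
  have hF : ∀ z ∈ F, columnMul a z ∈ F := by
    intro z hz i _
    refine sum_mem fun j _ => ?_
    -- The shifts cancel: an entry of degree `d j - d i` turns the bound `N - d j` into `max (n i j)
    -- (N - d i)`, which is `N - d i` by the choice of `N`.
    have h1 := mul_mem_filtration ((hm j).trans (hN₂' j)) (ha i j) (hz j trivial)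
    rw [show d j - d i + (k - d j) = k - d i by ring] at h1
    exact filtration_mono _ (max_le (hN₁' i j) (by linarith)) h1
  -- Here injectivity of the endomorphism enters: the lifted map is injective modulo relations.
  have hrel : ∀ z, columnMul a z ∈ relations p ↔ z ∈ relations p := fun z => by
    rw [mem_relations, mem_relations, hcomm, map_eq_zero_iff x hinj]
  obtain ⟨z', -, h⟩ := exists_sub_mem_of_invariant (columnMul a) F (relations p) hF hrel
    (show z ∈ F from fun j _ => filtration_mono _ (hN₂' j) (hz j))
  refine ⟨combination p z', ?_⟩
  rw [mem_relations, map_sub, sub_eq_zero, hcomm] at h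
  rw [← h, show ∑ j, op (c j) • (j : P.carrier) = ∑ j, op (c j) • p j from rfl,
    op_inr_smul_sum]
  simp only [mul_one]
  rfl

/-! ### The class of a non-zero vertex in `K0`. -/

theorem isIdempotentElem_inr_vertex (v : E.Vertex) :
    IsIdempotentElem (ZUnit.inr (gen ℓ E (.vertex v))) := by
  rw [IsIdempotentElem, ZUnit.inr_mul_inr, vertex_mul_self]

theorem inr_vertex_mem (v : E.Vertex) :
    ZUnit.inr (gen ℓ E (.vertex v)) ∈ unitGr (gr ℓ E) 0 :=
  ⟨zero_mem _, gen_mem (.vertex v)⟩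

/-- The class in `K₀` of the right ideal generated by a non-zero vertex is not zero. -/
theorem K0_of_vertex_ne_zero {v : E.Vertex} (hv : gen ℓ E (.vertex v) ≠ 0) :
    K0.of (GrProj.ofIdempotent (unitGr (gr ℓ E)) (isIdempotentElem_inr_vertex v)
      (inr_vertex_mem v)) ≠ 0 := by
  intro h
  let Q := GrProj.ofIdempotent (unitGr (gr ℓ E)) (isIdempotentElem_inr_vertex v)
    (inr_vertex_mem v)
  obtain ⟨P, e, he⟩ := K0.exists_iso_of_eq_zero (M := Q) h
  let e' : (Q.carrier × P.carrier) ≃ₗ[(ZUnit (E.LeavittPathAlgebra ℓ))ᵐᵒᵖ] P.carrier := e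
  let p : ZUnit (E.LeavittPathAlgebra ℓ) := ZUnit.inr (gen ℓ E (.vertex v))
  let g : Q.carrier := ULift.up ((leftMul p).rangeRestrict p)
  have hgp : (g.down : ZUnit (E.LeavittPathAlgebra ℓ)) = p := isIdempotentElem_inr_vertex v
  have hg : g ∈ Q.gr 0 := by
    change (g.down : ZUnit (E.LeavittPathAlgebra ℓ)) ∈ unitGr (gr ℓ E) 0
    rw [hgp]
    exact inr_vertex_mem v
  -- The generator lies in the unital part, the only part on which surjectivity is available.
  have hg1 : op (ZUnit.inr (1 : E.LeavittPathAlgebra ℓ)) • g = g := by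
    refine ULift.ext _ _ (Subtype.ext ?_)
    change (g.down : ZUnit (E.LeavittPathAlgebra ℓ)) *
      ZUnit.inr (1 : E.LeavittPathAlgebra ℓ) = g.down
    rw [hgp, ZUnit.inr_mul_inr, mul_one]
  -- The endomorphism is the inclusion of `P` into `Q ⊕ P` followed by the isomorphism with `P`, and
  -- the target is the image of `(g, 0)`.
  obtain ⟨y, hy⟩ := exists_eq_of_injective P (e'.toLinearMap ∘ₗ LinearMap.inr _ _ _)
    (e'.injective.comp LinearMap.inr_injective)
    (fun i m hm => (he i (0, m)).1 ⟨zero_mem _, hm⟩)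
    ((he 0 (g, 0)).1 ⟨hg, zero_mem _⟩)
  have hy' : e' (0, y) = e' (g, 0) := by
    refine hy.trans ((map_smul e' _ (g, (0 : P.carrier))).symm.trans ?_)
    rw [Prod.smul_mk, hg1, smul_zero]
  -- The elements `(0, y)` and `(g, 0)` have the same image, so their first components agree.
  have hg0 : g = 0 := (congrArg Prod.fst (e'.injective hy')).symm
  have hp : p = 0 := by
    rw [← hgp, hg0]
    rfl
  exact hv (congrArg ZUnit.snd hp)

end DirectedGraph.LeavittPathAlgebra

/-- Let `ℓ` be a field, `E` a finite graph, `R` a `ℤ`-graded `ℓ`-algebra (not necessarily unital)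
and `f : L(E) → R` a homomorphism of `ℤ`-graded algebras (not necessarily unit preserving). If
`K₀^gr(f)` is injective, then so is `f`. -/
theorem mainTheorem12 {ℓ : Type*} [Field ℓ] (E : DirectedGraph) [Fintype E.Vertex]
    [Fintype E.Edge] {R : Type*} [NonUnitalRing R] [Module ℓ R] [IsScalarTower ℓ R R]
    [SMulCommClass ℓ R R] (ℛ : ℤ → Submodule ℓ R) [SetLike.GradedMul ℛ]
    [DirectSum.Decomposition ℛ] (f : E.LeavittPathAlgebra ℓ →ₙₐ[ℓ] R)
    (hf : ∀ n, ∀ a ∈ DirectedGraph.LeavittPathAlgebra.gr ℓ E n, f a ∈ ℛ n)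
    (hK : Function.Injective
      (GradedK.K0gr.map (𝒜 := DirectedGraph.LeavittPathAlgebra.gr ℓ E) (ℬ := ℛ)
        (f : E.LeavittPathAlgebra ℓ →ₙ+* R) hf)) :
    Function.Injective f := by
  by_contra h
  obtain ⟨v, hfv, hv⟩ := DirectedGraph.LeavittPathAlgebra.exists_vertex_of_not_injective ℛ f hf h
  exact DirectedGraph.LeavittPathAlgebra.K0_of_vertex_ne_zero hv
    (GradedK.K0gr.of_ofIdempotent_eq_zero _ _ hf hfv hK)
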